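/- **Setting.** Let $d_\theta\ge 1$, $\Theta\subseteq\mathbb R^{d_\theta}$ (Euclidean norm), $\mathcal X\subseteq\mathbb R^{d_x}$, $\mathcal Y\subseteq\mathbb R^{d_y}$, $\mathcal Z\subseteq\mathbb R^{d_z}$; let $f_\theta:\mathcal X\to\mathcal Z$ ($\theta\in\Theta$) be measurable decision rules and $\Psi:\mathcal Z\times\mathcal Y\to\mathbb R$ a measurable loss. Let $\widehat{\mathbb P}$ be the empirical distribution of $n\ge1$ historical observations (covariate, outcome). For a historical covariate $\widehat x$ let $\widehat y_1,\dots,\widehat y_{n_{\widehat x}}$ be the distinct outcomes observed with it and $\widehat p(\widehat y_i\mid\widehat x)$ their empirical frequencies among the observations with covariate $\widehat x$. Fix $\lambda,\epsilon>0$ and $p\ge1$; let $Q_\epsilon$ and $W_\epsilon$ be the probability distributions with densities proportional to $e^{-\|\xi\|^p/\epsilon}$ with respect to nonzero reference measures $\nu_{\mathcal X}$ on $\mathbb R^{d_x}$ and $\nu_{\mathcal Y}$ on $\mathbb R^{d_y}$ (the normalizing integrals being finite). For every observation $(\widehat x,\widehat y)$, $\widehat x+\xi_1\in\mathcal X$ for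 $Q_\epsilon$-a.e. $\xi_1$ and $\widehat y+\xi_2\in\mathcal Y$ for $W_\epsilon$-a.e. $\xi_2$. Put $$t_1(z)=\log z,\qquad t_2(v;\widehat x)=\exp\Big(\sum_{i=1}^{n_{\widehat x}}\widehat p(\widehat y_i\mid\widehat x)\log v_i\Big),\qquad [t_3(\theta;\widehat x,\xi_1,\xi_2)]_i=\exp\Big(\tfrac{\Psi(f_\theta(\widehat x+\xi_1),\widehat y_i+\xi_2)}{\lambda\epsilon}\Big),$$ $\phi^{(2)}(\theta)=\mathbb E_{\xi_2\sim W_\epsilon}[t_3(\theta)]$, $\phi^{(1)}(\theta)=\mathbb E_{\xi_1\sim Q_\epsilon}[t_2(\phi^{(2)}(\theta))]$, and consider the problem of minimizing over $\Theta$ $$F(\theta)=\lambda\epsilon\,\mathbb E_{\widehat x\sim\widehat{\mathbb P}_{\widehat X}}\big[t_1(\phi^{(1)}(\theta))\big].$$ From mutually independent i.i.d. samples $(\widehat x^i,\widehat y^i)_{i\le N_1}$ of $\widehat{\mathbb P}$, $(\xi_1^j)_{j\le N_2}$ of $Q_\epsilon$, $(\xi_2^k)_{k\le N_3}$ of $W_\epsilon$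 ($N_1,N_2,N_3\ge1$) form the sample average approximation (SAA) $$\widehat F_{N_1,N_2,N_3}(\theta)=\frac{\lambda\epsilon}{N_1}\sum_{i=1}^{N_1}t_1\Big(\frac1{N_2}\sum_{j=1}^{N_2}t_2\Big(\frac1{N_3}\sum_{k=1}^{N_3}t_3(\theta;\widehat x^i,\xi_1^j,\xi_2^k);\widehat x^i\Big)\Big).$$ Let $\theta^*$ be a minimizer of $F$ over $\Theta$ and $\widehat\theta_{N_1,N_2,N_3}$ (almost surely) a minimizer of $\widehat F_{N_1,N_2,N_3}$ over $\Theta$. **Assumptions.** (i) $\|\theta_1-\theta_2\|\le D_\Theta$ for all $\theta_1,\theta_2\in\Theta$, where $0<D_\Theta<\infty$; (ii) for all $x\in\mathcal X$, $y\in\mathcal Y$, the map $\theta\mapsto\Psi(f_\theta(x),y)$ is $L_\theta$-Lipschitz on $\Theta$; (iii) $0\le\Psi\le B$ on $\mathcal Z\times\mathcal Y$. Put $L_1=1$, $L_2=e^{B/\lambda\epsilon}$, $L_3=\frac1{\lambda\epsilon}e^{B/\lambda\epsilon}$, and $\sigma_1^2=\sup_{\theta}\mathbb V_{\widehat x}(t_1(\phi^{(1)}(\theta)))$,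 $\sigma_2^2=\sup_{\theta,\widehat x}\mathbb V_{\xi_1}(t_2(\phi^{(2)}(\theta)))$, $\sigma_3^2=\sup_{\theta,\widehat x,\xi_1}\mathbb V_{\xi_2}(t_3(\theta))$, where $\widehat x$ runs through the historical covariates, $\xi_1$ through the points with $\widehat x+\xi_1\in\mathcal X$, and the variance of a random vector $V$ is $\mathbb E\|V-\mathbb EV\|^2$. An expression $\exp(-a/0)$ arising from some $\sigma_i^2=0$ is read as $0$. **Theorem.** There are absolute constants $C,c,c'>0$ such that, under the assumptions above, the following holds. 1. For every $\kappa>0$ there is $\delta_1>0$ (not depending on the sample sizes) such that for all $\delta\in(0,\delta_1)$, all $N_1,N_2,N_3\ge1$ and every historical covariate $\widehat x$, $$\begin{aligned}\Pr\big(F(\widehat\theta_{N_1,N_2,N_3})-F(\theta^*)>\delta\big)\le{}& C\Big(\frac{8L_1L_2L_3D_\Theta}{\delta}\Big)^{d_\theta}\Big(N_1N_2n_{\widehat x}\exp\Big(-\frac{N_3\delta^2}{144(2+\kappa)\lambda^2\epsilon^2L_1^2L_2^2\sigma_3^2}\Big)\\&+N_1\exp\Big(-\frac{N_2\delta^2}{144(2+\kappa)\lambda^2\epsilon^2L_1^2\sigma_2^2}\Big)+\exp\Big(-\frac{N_1\delta^2}{144(2+\kappa)\lambda^2\epsilon^2\sigma_1^2}\Big)\Big).\end{aligned}$$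 2. There is $\delta_1>0$ such that for all $\delta\in(0,\delta_1)$, $\alpha\in(0,1)$ and every historical covariate $\widehat x$: with probability at least $1-\alpha$, $F(\widehat\theta_{N_1,N_2,N_3})-F(\theta^*)\le\delta$, whenever $$\begin{aligned}N_1&>\frac{c\lambda^2\epsilon^2\sigma_1^2}{\delta^2}\Big[d_\theta\log\frac{8L_1L_2L_3D_\Theta}{\delta}+\log\frac1\alpha\Big],\\ N_2&>\frac{c\lambda^2\epsilon^2L_1^2\sigma_2^2}{\delta^2}\Big[d_\theta\log\frac{8L_1L_2L_3D_\Theta}{\delta}+\log\frac1\alpha+\log N_1\Big],\\ N_3&>\frac{c\lambda^2\epsilon^2L_1^2L_2^2\sigma_3^2}{\delta^2}\Big[d_\theta\log\frac{8L_1L_2L_3D_\Theta}{\delta}+\log\frac1\alpha+\log(N_1N_2n_{\widehat x})\Big].\end{aligned}$$ Moreover these conditions are satisfied by some $N_1,N_2,N_3\ge1$ whose total is of order $d_\theta/\delta^2$ up to a logarithmic factor: $$N_1+N_2+N_3\le 3+c'\lambda^2\epsilon^2\big(\sigma_1^2+L_1^2\sigma_2^2+L_1^2L_2^2\sigma_3^2\big)\frac{d_\theta}{\delta^2}\Big(\log\frac1\delta+\log\frac1\alpha\Big).$$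 -/

import Mathlib

open MeasureTheory ProbabilityTheory
open scoped ENNReal

noncomputable section

/-- The input data of the parametrised soft-constrained Causal Sinkhorn DRO problem (no hypotheses
yet).  `EX`, `EY`, `EZ` are the ambient spaces of covariates, uncertain parameters and decisions;
`d` is the dimension of the parameter and `n` the number of historical observations. -/
structure SCOProblem (EX EY EZ : Type*) [MeasurableSpace EX] [MeasurableSpace EY] (d n : ℕ) where
  /-- the set of admissible parameters -/
  Θ : Set (EuclideanSpace ℝ (Fin d))
  /-- the covariate space -/
  X : Set EX
  /-- the space of uncertain parameters -/
  Y : Set EY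
  /-- the decision space -/
  Z : Set EZ
  /-- the decision rule `f θ : X → Z` with parameter `θ` -/
  f : EuclideanSpace ℝ (Fin d) → EX → EZ
  /-- the loss function `Ψ : Z × Y → ℝ` -/
  Ψ : EZ → EY → ℝ
  /-- the historical observations (covariate, outcome) -/
  data : Fin n → EX × EY
  /-- the reference measure for the covariates -/
  νX : Measure EX
  /-- the reference measure for the uncertain parameters -/
  νY : Measure EY
  /-- the order of the transport cost -/
  p : ℝ
  /-- the entropic regularisation parameter -/
  eps : ℝ
  /-- the soft-constraint (dual) parameter -/
  lam : ℝ

namespace SCOProblem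

variable {EX EY EZ : Type*} [MeasurableSpace EX] [MeasurableSpace EY] {d n : ℕ}

/-- The nominal distribution: the empirical distribution of the historical observations. -/
def nominal (P : SCOProblem EX EY EZ d n) : Measure (EX × EY) :=
  (n : ℝ≥0∞)⁻¹ • ∑ m, Measure.dirac (P.data m)

/-- The kernel distribution of `ξ₁`, with density proportional to `exp (-‖ξ‖ ^ p / ε)` with respect
to the reference measure `νX`. -/
def Q [Norm EX] (P : SCOProblem EX EY EZ d n) : Measure EX :=
  P.νX.tilted (fun ξ => -‖ξ‖ ^ P.p / P.eps)

/-- The kernel distribution of `ξ₂`, with density proportional to `exp (-‖ξ‖ ^ p / ε)` with respect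
to the reference measure `νY`. -/
def W [Norm EY] (P : SCOProblem EX EY EZ d n) : Measure EY :=
  P.νY.tilted (fun ξ => -‖ξ‖ ^ P.p / P.eps)

open scoped Classical in
/-- The distinct outcomes `ŷ₁, …, ŷ_{n_x}` that were observed together with the covariate `x`. -/
def outcomes (P : SCOProblem EX EY EZ d n) (x : EX) : Finset EY :=
  (Finset.univ.filter (fun m => (P.data m).1 = x)).image (fun m => (P.data m).2)

/-- The number `n_x` of outcomes observed together with the covariate `x`. -/
def numOutcomes (P : SCOProblem EX EY EZ d n) (x : EX) : ℕ := (P.outcomes x).card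

open scoped Classical in
/-- The empirical frequency of the outcome `y` among the observations with covariate `x`. -/
def condProb (P : SCOProblem EX EY EZ d n) (y : EY) (x : EX) : ℝ :=
  ((Finset.univ.filter (fun m => P.data m = (x, y))).card : ℝ) /
    ((Finset.univ.filter (fun m => (P.data m).1 = x)).card : ℝ)

/-- The outer function `t₁ (z) = log z`. -/
def t₁ (z : ℝ) : ℝ := Real.log z

/-- The middle function `t₂ (v; x) = exp (∑ᵢ p̂(ŷᵢ | x) log vᵢ)`.  The coordinates of the vector `v`
are indexed by the outcomes observed with `x`; other values of `v` are not used. -/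
def t₂ (P : SCOProblem EX EY EZ d n) (x : EX) (v : EY → ℝ) : ℝ :=
  Real.exp (∑ y ∈ P.outcomes x, P.condProb y x * Real.log (v y))

/-- The inner vector-valued function
`[t₃ (θ; x, ξ₁, ŷ, ξ₂)]_y = exp (Ψ (f_θ (x + ξ₁), y + ξ₂) / (λ ε))`, with coordinate index `y`. -/
def t₃ [Add EX] [Add EY] (P : SCOProblem EX EY EZ d n) (θ : EuclideanSpace ℝ (Fin d))
    (x ξ₁ : EX) (ξ₂ : EY) : EY → ℝ :=
  fun y => Real.exp (P.Ψ (P.f θ (x + ξ₁)) (y + ξ₂) / (P.lam * P.eps))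

section normed

variable [NormedAddCommGroup EX] [NormedAddCommGroup EY]

/-- `φ⁽²⁾ (θ) = E_{ξ₂ ∼ W} [t₃ (θ)]`, coordinate by coordinate. -/
def φ₂ (P : SCOProblem EX EY EZ d n) (θ : EuclideanSpace ℝ (Fin d)) (x ξ₁ : EX) : EY → ℝ :=
  fun y => ∫ ξ₂, P.t₃ θ x ξ₁ ξ₂ y ∂P.W

/-- `φ⁽¹⁾ (θ) = E_{ξ₁ ∼ Q} [t₂ (φ⁽²⁾ (θ))]`. -/
def φ₁ (P : SCOProblem EX EY EZ d n) (θ : EuclideanSpace ℝ (Fin d)) (x : EX) : ℝ :=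
  ∫ ξ₁, P.t₂ x (P.φ₂ θ x ξ₁) ∂P.Q

/-- The objective of the three-level stochastic compositional optimisation problem:
`F (θ) = λ ε E_x [t₁ (E_{ξ₁} [t₂ (E_{ξ₂} [t₃ (θ)])])]`, with `x` distributed as the covariate
marginal of the nominal distribution. -/
def F (P : SCOProblem EX EY EZ d n) (θ : EuclideanSpace ℝ (Fin d)) : ℝ :=
  P.lam * P.eps * ∫ x, t₁ (P.φ₁ θ x) ∂(P.nominal.map Prod.fst)

/-- The space of samples: `N₁` pairs (covariate, outcome), `N₂` values of `ξ₁` and `N₃` values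
of `ξ₂`. -/
abbrev Sample (EX EY : Type*) (N₁ N₂ N₃ : ℕ) : Type _ :=
  (Fin N₁ → EX × EY) × (Fin N₂ → EX) × (Fin N₃ → EY)

/-- The law of the sample: all draws are independent, the pairs are drawn from the nominal
distribution, the `ξ₁` from `Q` and the `ξ₂` from `W`. -/
def sampleLaw (P : SCOProblem EX EY EZ d n) (N₁ N₂ N₃ : ℕ) : Measure (Sample EX EY N₁ N₂ N₃) :=
  (Measure.pi fun _ => P.nominal).prod ((Measure.pi fun _ => P.Q).prod (Measure.pi fun _ => P.W))

/-- The sample average approximation of the objective. -/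
def Fhat (P : SCOProblem EX EY EZ d n) {N₁ N₂ N₃ : ℕ} (s : Sample EX EY N₁ N₂ N₃)
    (θ : EuclideanSpace ℝ (Fin d)) : ℝ :=
  P.lam * P.eps / N₁ * ∑ i, t₁ ((1 / N₂ : ℝ) * ∑ j, P.t₂ (s.1 i).1
    (fun y => (1 / N₃ : ℝ) * ∑ k, P.t₃ θ (s.1 i).1 (s.2.1 j) (s.2.2 k) y))

/-- `σ₁² = sup_θ V_x (t₁ (φ⁽¹⁾ (θ)))`. -/
def sigmaSq₁ (P : SCOProblem EX EY EZ d n) : ℝ :=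
  sSup {v | ∃ θ ∈ P.Θ, v = Var[fun x => t₁ (P.φ₁ θ x); P.nominal.map Prod.fst]}

/-- `σ₂² = sup_{θ, x} V_{ξ₁} (t₂ (φ⁽²⁾ (θ)))`, where `x` runs through the historical covariates. -/
def sigmaSq₂ (P : SCOProblem EX EY EZ d n) : ℝ :=
  sSup {v | ∃ θ ∈ P.Θ, ∃ m, v = Var[fun ξ₁ => P.t₂ (P.data m).1 (P.φ₂ θ (P.data m).1 ξ₁); P.Q]}

/-- `σ₃² = sup_{θ, x, ξ₁} V_{ξ₂} (t₃ (θ))`, where `x` runs through the historical covariates and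
`x + ξ₁` stays in the covariate space.  The variance of a random vector, `E ‖V - E V‖²`, is the sum
of the variances of its coordinates. -/
def sigmaSq₃ (P : SCOProblem EX EY EZ d n) : ℝ :=
  sSup {v | ∃ θ ∈ P.Θ, ∃ m, ∃ ξ₁, (P.data m).1 + ξ₁ ∈ P.X ∧
    v = ∑ y ∈ P.outcomes (P.data m).1, Var[fun ξ₂ => P.t₃ θ (P.data m).1 ξ₁ ξ₂ y; P.W]}

/-- What is needed for the problem to make sense: the parameters are in their ranges, the kernel
distributions are well-defined probability distributions, the functions are measurable, and the
arguments at which the decision rule and the loss are evaluated lie almost surely in their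
domains. -/
structure WellPosed [MeasurableSpace EZ] (P : SCOProblem EX EY EZ d n) : Prop where
  one_le_p : 1 ≤ P.p
  eps_pos : 0 < P.eps
  lam_pos : 0 < P.lam
  νX_ne_zero : P.νX ≠ 0
  νY_ne_zero : P.νY ≠ 0
  integrable_X : Integrable (fun u => Real.exp (-‖u‖ ^ P.p / P.eps)) P.νX
  integrable_Y : Integrable (fun u => Real.exp (-‖u‖ ^ P.p / P.eps)) P.νY
  measurable_Ψ : Measurable (Function.uncurry P.Ψ)
  measurable_f : ∀ θ ∈ P.Θ, Measurable (P.f θ)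
  f_mem : ∀ θ ∈ P.Θ, ∀ x ∈ P.X, P.f θ x ∈ P.Z
  add_mem_X : ∀ m, ∀ᵐ ξ₁ ∂P.Q, (P.data m).1 + ξ₁ ∈ P.X
  add_mem_Y : ∀ m, ∀ᵐ ξ₂ ∂P.W, (P.data m).2 + ξ₂ ∈ P.Y

/-- Bounded diameter of the parameter set, Lipschitz continuity of the loss in the parameter, and
boundedness of the loss. -/
structure BoundedLipschitz (P : SCOProblem EX EY EZ d n) (D Lθ B : ℝ) : Prop where
  diam_pos : 0 < D
  dist_le : ∀ θ₁ ∈ P.Θ, ∀ θ₂ ∈ P.Θ, ‖θ₁ - θ₂‖ ≤ D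
  lipschitz : ∀ x ∈ P.X, ∀ y ∈ P.Y, ∀ θ₁ ∈ P.Θ, ∀ θ₂ ∈ P.Θ,
    |P.Ψ (P.f θ₁ x) y - P.Ψ (P.f θ₂ x) y| ≤ Lθ * ‖θ₁ - θ₂‖
  bounded : ∀ z ∈ P.Z, ∀ y ∈ P.Y, 0 ≤ P.Ψ z y ∧ P.Ψ z y ≤ B

/-- `L₁ = 1`, a Lipschitz constant of `t₁`. -/
def L₁ : ℝ := 1

/-- `L₂ = exp (B / (λ ε))`, a Lipschitz constant of `t₂`. -/
def L₂ (P : SCOProblem EX EY EZ d n) (B : ℝ) : ℝ := Real.exp (B / (P.lam * P.eps))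

/-- `L₃ = exp (B / (λ ε)) / (λ ε)`, a Lipschitz constant of `t₃` as a function of the loss. -/
def L₃ (P : SCOProblem EX EY EZ d n) (B : ℝ) : ℝ :=
  1 / (P.lam * P.eps) * Real.exp (B / (P.lam * P.eps))

/-- The quantity `8 L₁ L₂ L₃ D / δ`. -/
def coverRatio (P : SCOProblem EX EY EZ d n) (D B δ : ℝ) : ℝ :=
  8 * L₁ * P.L₂ B * P.L₃ B * D / δ

/-- `exp (-N δ² / V)`, which is read as `exp (-∞) = 0` if the variance proxy `V` vanishes. -/
def expTerm (N : ℕ) (δ V : ℝ) : ℝ := if V = 0 then 0 else Real.exp (-(N * δ ^ 2 / V))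

/-- The sum of the three exponential terms in the tail bound. -/
def tailSum (P : SCOProblem EX EY EZ d n) (B κ δ : ℝ) (N₁ N₂ N₃ : ℕ) (x : EX) : ℝ :=
  N₁ * N₂ * P.numOutcomes x * expTerm N₃ δ
      (144 * (2 + κ) * P.lam ^ 2 * P.eps ^ 2 * L₁ ^ 2 * P.L₂ B ^ 2 * P.sigmaSq₃)
    + N₁ * expTerm N₂ δ (144 * (2 + κ) * P.lam ^ 2 * P.eps ^ 2 * L₁ ^ 2 * P.sigmaSq₂)
    + expTerm N₁ δ (144 * (2 + κ) * P.lam ^ 2 * P.eps ^ 2 * P.sigmaSq₁)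

/-- The lower bounds on the three sample sizes, with leading constant `c (λ ε)²`. -/
def SampleSizesLarge (P : SCOProblem EX EY EZ d n) (c D B δ α : ℝ) (N₁ N₂ N₃ : ℕ) (x : EX) :
    Prop :=
  c * (P.lam * P.eps) ^ 2 * P.sigmaSq₁ / δ ^ 2 *
      (d * Real.log (P.coverRatio D B δ) + Real.log (1 / α)) < N₁ ∧
  c * (P.lam * P.eps) ^ 2 * (L₁ ^ 2 * P.sigmaSq₂) / δ ^ 2 *
      (d * Real.log (P.coverRatio D B δ) + Real.log (1 / α) + Real.log N₁) < N₂ ∧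
  c * (P.lam * P.eps) ^ 2 * (L₁ ^ 2 * P.L₂ B ^ 2 * P.sigmaSq₃) / δ ^ 2 *
      (d * Real.log (P.coverRatio D B δ) + Real.log (1 / α)
        + Real.log (N₁ * N₂ * P.numOutcomes x)) < N₃

/-- `θ` is an optimal solution of the minimisation of `G` over the parameter set. -/
def IsSolution (P : SCOProblem EX EY EZ d n) (G : EuclideanSpace ℝ (Fin d) → ℝ)
    (θ : EuclideanSpace ℝ (Fin d)) : Prop :=
  θ ∈ P.Θ ∧ ∀ θ' ∈ P.Θ, G θ ≤ G θ'

end normed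

end SCOProblem

end

/-! The argument is uniform convergence: if `Fhat` and `F` differ by at most `ρ` on all of `Θ`, a
minimizer of `Fhat` has optimality gap at most `2ρ` for `F`. Three ingredients give such a `ρ`.

Lipschitz dependence on the parameter. Moving `θ` so that the loss changes by at most `τ` multiplies
`t₃` by at most `exp (τ / (λε))`. This factor passes unchanged through averages and expectations and
through `t₂`, a weighted geometric mean, and the final `λε log` turns it back into `τ`. Hence `F`,
and `Fhat` for almost every sample, change by at most `τ` (`F_le_add`, `Fhat_le_add`), and it
suffices to control a finite net of `Θ` (`exists_finset_net`).

Concentration at a net point. On the range `[1, L₂]` of the inner quantities, `log` is 1-Lipschitz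
and `t₂` is `L₂`-Lipschitz for the sup norm, so the error of `Fhat` is at most the sum of the errors
of three one-level averages (`abs_Fhat_sub_F_le`). Each has a tail `2 exp (-N η² / (4 σ²))` for
small `η`, by a Chernoff bound that sees the variance (`measureReal_pi_abs_mean_sub_le`). The inner
level is treated conditionally on the `ξ₁` sample. A union bound over net, historical covariates,
outcomes and `ξ₁` draws gives `measureReal_optimalityGap_gt_le`.

Absorbing constants. The exponents so obtained exceed the claimed ones by a factor of at least
`7/5`. When the claimed bound is below 1, each claimed exponent exceeds `d log A`, with `A` the
cover ratio, so the surplus beats every factor independent of `δ`, such as `n²` or the net constant,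
once `δ` is small (`mul_expTerm_le_expTerm`). This is why `C = 1` works. The sample sizes then come
from making each of the three terms at most `α / 3`. -/

noncomputable section

/-! ### Variance-sensitive concentration of sample means -/

section Concentration

variable {T : Type*} [MeasurableSpace T] {ν : Measure T} [IsProbabilityMeasure ν]

/-- Integrate `exp u ≤ 1 + u + u²`, valid for `|u| ≤ 1`; the linear term has mean zero. -/
theorem integral_exp_mul_le_of_abs_le {h : T → ℝ} {b v t : ℝ} (hm : AEMeasurable h ν)
    (hb : ∀ᵐ x ∂ν, |h x| ≤ b) (h0 : ∫ x, h x ∂ν = 0) (hv : ∫ x, h x ^ 2 ∂ν ≤ v) (ht : 0 ≤ t)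
    (htb : t * b ≤ 1) : ∫ x, Real.exp (t * h x) ∂ν ≤ Real.exp (t ^ 2 * v) := by
  have hi : Integrable h ν := Integrable.of_bound hm.aestronglyMeasurable b hb
  have hi2 : Integrable (fun x => h x ^ 2) ν := by
    refine Integrable.of_bound (hm.pow_const 2).aestronglyMeasurable (b ^ 2) ?_
    filter_upwards [hb] with x hx
    rw [Real.norm_eq_abs, abs_pow]
    exact pow_le_pow_left₀ (abs_nonneg _) hx 2
  calc ∫ x, Real.exp (t * h x) ∂ν ≤ ∫ x, (1 + t * h x + t ^ 2 * h x ^ 2) ∂ν := by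
        refine integral_mono_of_nonneg (.of_forall fun x => (Real.exp_pos _).le)
          (((integrable_const _).add (hi.const_mul t)).add (hi2.const_mul (t ^ 2))) ?_
        filter_upwards [hb] with x hx
        have h1 : |t * h x| ≤ 1 := by
          rw [abs_mul, abs_of_nonneg ht]
          exact (mul_le_mul_of_nonneg_left hx ht).trans htb
        have := (abs_le.1 (Real.abs_exp_sub_one_sub_id_le h1)).2
        rw [mul_pow] at this
        linarith
    _ = 1 + t ^ 2 * ∫ x, h x ^ 2 ∂ν := by
        have h1 : Integrable (fun x => 1 + t * h x) ν := (integrable_const _).add (hi.const_mul t)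
        rw [integral_add h1 (hi2.const_mul (t ^ 2)),
          integral_add (integrable_const _) (hi.const_mul t), integral_const_mul,
          integral_const_mul, h0]
        simp
    _ ≤ 1 + t ^ 2 * v := by gcongr
    _ ≤ Real.exp (t ^ 2 * v) := by linarith [Real.add_one_le_exp (t ^ 2 * v)]

/-- Chernoff bound at `t = η / (2v)`, the minimizer of `-tη + t²v`. The condition `η * b ≤ 2 * v`
says precisely that `t * b ≤ 1` for this choice, so the moment bound applies. -/
theorem measureReal_pi_le_sum_le_exp {h : T → ℝ} {b v η : ℝ} (hm : AEMeasurable h ν)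
    (hb : ∀ᵐ x ∂ν, |h x| ≤ b) (h0 : ∫ x, h x ∂ν = 0) (hv : ∫ x, h x ^ 2 ∂ν ≤ v) (hv0 : 0 < v)
    (hη : 0 ≤ η) (hηb : η * b ≤ 2 * v) (N : ℕ) :
    (Measure.pi fun _ : Fin N => ν).real {ω | N * η ≤ ∑ i, h (ω i)} ≤
      Real.exp (-(N * η ^ 2 / (4 * v))) := by
  set t := η / (2 * v) with htd
  have ht : 0 ≤ t := by positivity
  have htb : t * b ≤ 1 := by
    rw [htd, div_mul_eq_mul_div]
    exact div_le_one_of_le₀ hηb (by positivity)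
  have hexp : ∀ ω : Fin N → T, Real.exp (t * ∑ i, h (ω i)) = ∏ i, Real.exp (t * h (ω i)) := by
    intro ω
    rw [Finset.mul_sum, Real.exp_sum]
  have hint : Integrable (fun x => Real.exp (t * h x)) ν := by
    refine Integrable.of_bound (Real.measurable_exp.comp_aemeasurable
      (hm.const_mul t)).aestronglyMeasurable (Real.exp 1) ?_
    filter_upwards [hb] with x hx
    rw [Real.norm_eq_abs, Real.abs_exp]
    exact Real.exp_le_exp.2 (((mul_le_mul_of_nonneg_left ((le_abs_self _).trans hx) ht)).trans htb)
  have hint' : Integrable (fun ω : Fin N → T => Real.exp (t * ∑ i, h (ω i)))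
      (Measure.pi fun _ => ν) := by
    simp_rw [hexp]
    exact Integrable.fintype_prod (fun _ => hint)
  refine (measure_ge_le_exp_mul_mgf (N * η) ht hint').trans ?_
  have hmgf : mgf (fun ω : Fin N → T => ∑ i, h (ω i)) (Measure.pi fun _ => ν) t ≤
      Real.exp (N * (t ^ 2 * v)) := by
    rw [mgf]
    simp_rw [hexp]
    rw [integral_fintype_prod_eq_pow (ι := Fin N) (μ := ν) (fun x => Real.exp (t * h x)),
      Fintype.card_fin, Real.exp_nat_mul]
    exact pow_le_pow_left₀ (integral_nonneg fun x => (Real.exp_pos _).le)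
      (integral_exp_mul_le_of_abs_le hm hb h0 hv ht htb) N
  refine (mul_le_mul_of_nonneg_left hmgf (Real.exp_pos _).le).trans ?_
  rw [← Real.exp_add]
  refine Real.exp_le_exp.2 (le_of_eq ?_)
  rw [htd]
  field_simp
  ring

theorem integral_mem_Icc {g : T → ℝ} {a c : ℝ} (hm : AEMeasurable g ν) (hg : ∀ᵐ x ∂ν, g x ∈ Set.Icc a c) :
    ∫ x, g x ∂ν ∈ Set.Icc a c := by
  have hi : Integrable g ν := Integrable.of_mem_Icc a c hm hg
  have h1 := integral_mono_ae (integrable_const a) hi (hg.mono fun x hx => hx.1)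
  have h2 := integral_mono_ae hi (integrable_const c) (hg.mono fun x hx => hx.2)
  simp only [integral_const, probReal_univ, smul_eq_mul, one_mul] at h1 h2
  exact ⟨h1, h2⟩

theorem measureReal_pi_abs_mean_sub_le {g : T → ℝ} {a c v η : ℝ} (hm : AEMeasurable g ν)
    (hg : ∀ᵐ x ∂ν, g x ∈ Set.Icc a c) (hv : Var[g; ν] ≤ v) (hη : 0 < η)
    (hηv : 0 < v → η * (c - a) ≤ 2 * v) {N : ℕ} (hN : 0 < N) :
    (Measure.pi fun _ : Fin N => ν).real
        {ω | η < |(1 / N : ℝ) * ∑ i, g (ω i) - ∫ x, g x ∂ν|} ≤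
      2 * SCOProblem.expTerm N η (4 * v) := by
  have hN' : (0 : ℝ) < N := Nat.cast_pos.2 hN
  have hi : Integrable g ν := Integrable.of_mem_Icc a c hm hg
  set M := ∫ x, g x ∂ν with hM
  have hMac : M ∈ Set.Icc a c := integral_mem_Icc hm hg
  have hmean : ∀ ω : Fin N → T, (1 / N : ℝ) * ∑ i, g (ω i) - M = 1 / N * ∑ i, (g (ω i) - M) := by
    intro ω
    rw [Finset.sum_sub_distrib]
    simp
    field_simp
  have hv0 : 0 ≤ v := (variance_nonneg _ _).trans hv
  rcases hv0.eq_or_lt with h0 | hpos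
  -- With zero variance `g` is almost surely its mean and the event is null, which matches the value
  -- 0 that `expTerm` takes there.
  · have hV : Var[g; ν] = 0 := le_antisymm (hv.trans h0.symm.le) (variance_nonneg _ _)
    have hae := ae_eq_integral_of_variance_eq_zero
      (memLp_of_bounded hg hm.aestronglyMeasurable 2) hV
    have hae' : ∀ᵐ ω ∂(Measure.pi fun _ : Fin N => ν), ∀ i, g (ω i) = M :=
      ae_all_iff.2 fun i =>
        (measurePreserving_eval (fun _ : Fin N => ν) i).quasiMeasurePreserving.ae hae
    have : (Measure.pi fun _ : Fin N => ν).real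
        {ω | η < |(1 / N : ℝ) * ∑ i, g (ω i) - M|} = 0 := by
      rw [measureReal_def, measure_eq_zero_iff_ae_notMem.2, ENNReal.toReal_zero]
      filter_upwards [hae'] with ω hω
      rw [hmean]
      simp [hω, hη.le]
    rw [this]
    simp [SCOProblem.expTerm, ← h0]
  · have hb : ∀ᵐ x ∂ν, |g x - M| ≤ c - a := by
      filter_upwards [hg] with x hx
      rw [abs_le]
      constructor <;> linarith [hx.1, hx.2, hMac.1, hMac.2]
    have hb' : ∀ᵐ x ∂ν, |-(g x - M)| ≤ c - a := by simpa only [abs_neg] using hb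
    have hc0 : ∫ x, (g x - M) ∂ν = 0 := by
      rw [integral_sub hi (integrable_const _)]
      simp [hM]
    have hc0' : ∫ x, -(g x - M) ∂ν = 0 := by rw [integral_neg, hc0, neg_zero]
    have hvv : ∫ x, (g x - M) ^ 2 ∂ν ≤ v := by rwa [← variance_eq_integral hm]
    have hvv' : ∫ x, (-(g x - M)) ^ 2 ∂ν ≤ v := by simpa only [neg_sq] using hvv
    have h1 := measureReal_pi_le_sum_le_exp (hm.sub_const M) hb hc0 hvv hpos hη.le (hηv hpos) N
    have h2 := measureReal_pi_le_sum_le_exp (hm.sub_const M).neg hb' hc0' hvv' hpos hη.le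
      (hηv hpos) N
    rw [SCOProblem.expTerm, if_neg (by positivity)]
    have hsub : {ω : Fin N → T | η < |(1 / N : ℝ) * ∑ i, g (ω i) - M|} ⊆
        {ω | N * η ≤ ∑ i, (g (ω i) - M)} ∪ {ω | N * η ≤ ∑ i, -(g (ω i) - M)} := by
      intro ω hω
      simp only [Set.mem_ofPred_eq, hmean] at hω
      rw [abs_mul, abs_of_pos (by positivity), one_div, inv_mul_eq_div, lt_div_iff₀ hN'] at hω
      rcases lt_abs.1 hω with h | h
      · left
        simp only [Set.mem_ofPred_eq]
        linarith
      · right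
        simp only [Set.mem_ofPred_eq, Finset.sum_neg_distrib]
        linarith
    calc _ ≤ _ := measureReal_mono hsub
      _ ≤ _ := measureReal_union_le _ _
      _ ≤ Real.exp (-(N * η ^ 2 / (4 * v))) + Real.exp (-(N * η ^ 2 / (4 * v))) := add_le_add h1 h2
      _ = _ := by ring

end Concentration

/-! ### Finite nets of the parameter set -/

/-- A bounded subset of `ℝ ^ d` has a finite net of radius `r` with at most `(5 d D / r) ^ d`
points. -/
theorem exists_finset_net {d : ℕ} (hd : 0 < d) {Θ : Set (EuclideanSpace ℝ (Fin d))} {D r : ℝ}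
    (hne : Θ.Nonempty) (hD : ∀ θ₁ ∈ Θ, ∀ θ₂ ∈ Θ, ‖θ₁ - θ₂‖ ≤ D) (hr : 0 < r) (hrD : r ≤ D) :
    ∃ A : Finset (EuclideanSpace ℝ (Fin d)), (∀ θ ∈ A, θ ∈ Θ) ∧
      (∀ θ ∈ Θ, ∃ θ' ∈ A, ‖θ - θ'‖ ≤ r) ∧ (A.card : ℝ) ≤ (5 * d * D / r) ^ d := by
  classical
  obtain ⟨θ₀, hθ₀⟩ := hne
  have hd' : (1 : ℝ) ≤ d := by exact_mod_cast hd
  have hd0 : (0 : ℝ) < d := by linarith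
  -- Cubes of side `r / d` have Euclidean diameter at most `√d · r / d ≤ r`. One point of `Θ` is
  -- picked in each cube that meets `Θ`, so that the net lies in `Θ`, where the hypotheses hold.
  set h : ℝ := r / d with hh
  have hh0 : 0 < h := by positivity
  set q : ℕ := ⌈D / h⌉₊ with hq
  set cell : EuclideanSpace ℝ (Fin d) → Fin d → ℤ := fun θ i => ⌊(θ i - θ₀ i) / h⌋ with hcell
  set box : Finset (Fin d → ℤ) := Fintype.piFinset fun _ => Finset.Icc (-(q : ℤ)) q with hbox
  have hco : ∀ (v : EuclideanSpace ℝ (Fin d)) (i), |v i| ≤ ‖v‖ := fun v i => by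
    simpa using PiLp.norm_apply_le v i
  have hmem : ∀ θ ∈ Θ, cell θ ∈ box := by
    intro θ hθ
    rw [hbox, Fintype.mem_piFinset]
    intro i
    have h1 : |θ i - θ₀ i| ≤ D := by
      have := hco (θ - θ₀) i
      rw [PiLp.sub_apply] at this
      exact this.trans (hD θ hθ θ₀ hθ₀)
    have h2 : |(θ i - θ₀ i) / h| ≤ q := by
      rw [abs_div, abs_of_pos hh0]
      exact (div_le_div_of_nonneg_right h1 hh0.le).trans (Nat.le_ceil _)
    rw [Finset.mem_Icc]
    constructor
    · rw [hcell]
      refine Int.le_floor.2 ?_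
      push_cast
      exact (abs_le.1 h2).1
    · have := (Int.floor_le ((θ i - θ₀ i) / h)).trans (abs_le.1 h2).2
      refine Int.cast_le (R := ℝ).1 ?_
      rw [Int.cast_natCast]
      exact this
  set pick : (Fin d → ℤ) → EuclideanSpace ℝ (Fin d) := fun u =>
    if hu : ∃ θ ∈ Θ, cell θ = u then hu.choose else θ₀ with hpick
  refine ⟨box.image pick, ?_, ?_, ?_⟩
  · intro θ hθ
    obtain ⟨u, -, rfl⟩ := Finset.mem_image.1 hθ
    rw [hpick]
    dsimp only
    split_ifs with hu
    · exact hu.choose_spec.1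
    · exact hθ₀
  · intro θ hθ
    refine ⟨pick (cell θ), Finset.mem_image_of_mem _ (hmem θ hθ), ?_⟩
    have hu : ∃ θ' ∈ Θ, cell θ' = cell θ := ⟨θ, hθ, rfl⟩
    have hc : cell (pick (cell θ)) = cell θ := by
      rw [hpick]
      dsimp only
      rw [dif_pos hu]
      exact hu.choose_spec.2
    set θ' := pick (cell θ)
    have hi : ∀ i, |θ i - θ' i| ≤ h := by
      intro i
      have h1 : ⌊(θ' i - θ₀ i) / h⌋ = ⌊(θ i - θ₀ i) / h⌋ := congrFun hc i
      have h2 := Int.abs_sub_lt_one_of_floor_eq_floor h1.symm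
      rw [← sub_div, abs_div, abs_of_pos hh0, div_lt_one hh0] at h2
      have h3 : θ i - θ₀ i - (θ' i - θ₀ i) = θ i - θ' i := by ring
      rw [h3] at h2
      exact h2.le
    rw [EuclideanSpace.norm_eq, Real.sqrt_le_left hr.le]
    calc ∑ i, ‖(θ - θ').ofLp i‖ ^ 2 ≤ ∑ _i : Fin d, h ^ 2 := by
          refine Finset.sum_le_sum fun i _ => pow_le_pow_left₀ (norm_nonneg _) ?_ 2
          rw [Real.norm_eq_abs]
          exact hi i
      _ = d * h ^ 2 := by simp
      _ ≤ d * (d * h ^ 2) := by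
          have : (0 : ℝ) ≤ d * h ^ 2 := by positivity
          nlinarith
      _ = r ^ 2 := by
          rw [hh]
          field_simp
  · have h1 : (box.image pick).card ≤ (2 * q + 1) ^ d := by
      refine Finset.card_image_le.trans (le_of_eq ?_)
      rw [hbox, Fintype.card_piFinset]
      simp only [Int.card_Icc, Finset.prod_const, Finset.card_univ, Fintype.card_fin]
      congr 1
      omega
    -- Here `2q + 1 ≤ 2dD/r + 3`, and `dD/r ≥ 1` absorbs the 3 into the constant 5.
    have h2 : ((2 * q + 1 : ℕ) : ℝ) ≤ 5 * d * D / r := by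
      have h3 : (q : ℝ) < D / h + 1 := Nat.ceil_lt_add_one (by
        have : 0 < D := hr.trans_le hrD
        positivity)
      have h4 : D / h = d * (D / r) := by
        rw [hh]
        field_simp
      have h5 : 1 ≤ D / r := (one_le_div hr).2 hrD
      have h6 : 1 ≤ d * (D / r) := by nlinarith
      have h7 : 5 * d * D / r = 5 * (d * (D / r)) := by ring
      push_cast
      rw [h7]
      linarith
    calc ((box.image pick).card : ℝ) ≤ ((2 * q + 1 : ℕ) : ℝ) ^ d := by exact_mod_cast h1
      _ ≤ _ := pow_le_pow_left₀ (Nat.cast_nonneg _) h2 d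

end

noncomputable section

/-! ### Elementary estimates for averages and logarithms -/

section Mean

variable {N : ℕ} {g h : Fin N → ℝ}

theorem mean_mem_Icc {a c : ℝ} (hN : 0 < N) (hg : ∀ i, g i ∈ Set.Icc a c) :
    (1 / N : ℝ) * ∑ i, g i ∈ Set.Icc a c := by
  have hN' : (0 : ℝ) < N := Nat.cast_pos.2 hN
  rw [one_div, inv_mul_eq_div, Set.mem_Icc, le_div_iff₀ hN', div_le_iff₀ hN']
  have h1 := Finset.sum_le_sum fun i (_ : i ∈ Finset.univ) => (hg i).1
  have h2 := Finset.sum_le_sum fun i (_ : i ∈ Finset.univ) => (hg i).2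
  simp only [Finset.sum_const, Finset.card_univ, Fintype.card_fin, nsmul_eq_mul] at h1 h2
  constructor <;> linarith

theorem mean_le_mul {K : ℝ} (hgh : ∀ i, g i ≤ K * h i) :
    (1 / N : ℝ) * ∑ i, g i ≤ K * ((1 / N : ℝ) * ∑ i, h i) := by
  rw [mul_left_comm K, Finset.mul_sum _ _ K]
  exact mul_le_mul_of_nonneg_left (Finset.sum_le_sum fun i _ => hgh i)
    (one_div_nonneg.2 (Nat.cast_nonneg N))

theorem abs_mean_sub_mean_le {η : ℝ} (hN : 0 < N) (hgh : ∀ i, |g i - h i| ≤ η) :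
    |(1 / N : ℝ) * ∑ i, g i - (1 / N : ℝ) * ∑ i, h i| ≤ η := by
  rw [← mul_sub, ← Finset.sum_sub_distrib, abs_le]
  exact mean_mem_Icc hN fun i => abs_le.1 (hgh i)

end Mean

theorem abs_log_sub_log_le {v w : ℝ} (hv : 1 ≤ v) (hw : 1 ≤ w) :
    |Real.log v - Real.log w| ≤ |v - w| := by
  have key : ∀ a b : ℝ, 1 ≤ a → 1 ≤ b → Real.log a - Real.log b ≤ |a - b| := by
    intro a b ha hb
    have ha0 : 0 < a := by linarith
    have hb0 : 0 < b := by linarith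
    rw [← Real.log_div ha0.ne' hb0.ne']
    calc Real.log (a / b) ≤ a / b - 1 := Real.log_le_sub_one_of_pos (by positivity)
      _ = (a - b) / b := by field_simp
      _ ≤ |a - b| / b := by gcongr; exact le_abs_self _
      _ ≤ |a - b| := div_le_self (abs_nonneg _) hb
  rw [abs_sub_le_iff]
  refine ⟨key v w hv hw, ?_⟩
  rw [abs_sub_comm]
  exact key w v hw hv

namespace SCOProblem

/-! ### Empirical frequencies and the nominal distribution -/

section Frequencies

variable {EX EY EZ : Type*} [MeasurableSpace EX] [MeasurableSpace EY] {d n : ℕ}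
  {P : SCOProblem EX EY EZ d n}

theorem mem_outcomes {x : EX} {y : EY} : y ∈ P.outcomes x ↔ ∃ m, P.data m = (x, y) := by
  classical
  simp only [outcomes, Finset.mem_image, Finset.mem_filter, Finset.mem_univ, true_and]
  constructor
  · rintro ⟨m, h1, h2⟩
    exact ⟨m, Prod.ext h1 h2⟩
  · rintro ⟨m, hm⟩
    exact ⟨m, by simp [hm]⟩

theorem numOutcomes_le (x : EX) : P.numOutcomes x ≤ n := by
  classical
  rw [numOutcomes, outcomes]
  refine Finset.card_image_le.trans ((Finset.card_le_univ _).trans ?_)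
  simp

theorem numOutcomes_pos (m : Fin n) : 0 < P.numOutcomes (P.data m).1 :=
  Finset.card_pos.2 ⟨(P.data m).2, mem_outcomes.2 ⟨m, rfl⟩⟩

theorem condProb_nonneg (x : EX) (y : EY) : 0 ≤ P.condProb y x := by
  rw [condProb]
  positivity

theorem sum_condProb (m : Fin n) :
    ∑ y ∈ P.outcomes (P.data m).1, P.condProb y (P.data m).1 = 1 := by
  classical
  set x := (P.data m).1 with hx
  simp only [condProb]
  rw [← Finset.sum_div]
  have hpos : 0 < (Finset.univ.filter fun m => (P.data m).1 = x).card :=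
    Finset.card_pos.2 ⟨m, by simp [hx]⟩
  rw [div_eq_one_iff_eq (by positivity)]
  have h := Finset.card_eq_sum_card_image (fun m => (P.data m).2)
    (Finset.univ.filter fun m => (P.data m).1 = x)
  rw [h]
  push_cast
  refine Finset.sum_congr ?_ fun y _ => ?_
  · ext y
    simp [mem_outcomes, Prod.ext_iff]
  · congr 2
    ext k
    simp [Prod.ext_iff]

theorem isProbabilityMeasure_nominal (hn : 0 < n) : IsProbabilityMeasure P.nominal := by
  constructor
  simp only [nominal, Measure.smul_apply, Measure.coe_finsetSum, Finset.sum_apply, measure_univ,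
    Finset.sum_const, Finset.card_univ, Fintype.card_fin, smul_eq_mul, nsmul_eq_mul, mul_one]
  exact ENNReal.inv_mul_cancel (by exact_mod_cast hn.ne') (ENNReal.natCast_ne_top n)

end Frequencies

/-! ### The middle function as a weighted geometric mean -/

section Middle

variable {EX EY EZ : Type*} [MeasurableSpace EX] [MeasurableSpace EY] {d n : ℕ}
  {P : SCOProblem EX EY EZ d n} {B : ℝ} {m : Fin n} {v w : EY → ℝ}

theorem t₂_mem_Icc (hv : ∀ y ∈ P.outcomes (P.data m).1, v y ∈ Set.Icc 1 (P.L₂ B)) :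
    P.t₂ (P.data m).1 v ∈ Set.Icc 1 (P.L₂ B) := by
  have hlog : ∀ y ∈ P.outcomes (P.data m).1,
      0 ≤ Real.log (v y) ∧ Real.log (v y) ≤ B / (P.lam * P.eps) := by
    intro y hy
    refine ⟨Real.log_nonneg (hv y hy).1, ?_⟩
    rw [← Real.log_exp (B / (P.lam * P.eps))]
    exact Real.log_le_log (zero_lt_one.trans_le (hv y hy).1) (hv y hy).2
  rw [t₂, L₂, Set.mem_Icc, Real.one_le_exp_iff, Real.exp_le_exp]
  refine ⟨Finset.sum_nonneg fun y hy => mul_nonneg (condProb_nonneg _ _) (hlog y hy).1, ?_⟩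
  calc _ ≤ ∑ y ∈ P.outcomes (P.data m).1, P.condProb y (P.data m).1 * (B / (P.lam * P.eps)) :=
        Finset.sum_le_sum fun y hy =>
          mul_le_mul_of_nonneg_left (hlog y hy).2 (condProb_nonneg _ _)
    _ = _ := by rw [← Finset.sum_mul, sum_condProb, one_mul]

/-- A geometric mean with weights of sum 1 is monotone and homogeneous of degree 1, so a common
factor passes through it without loss. -/
theorem t₂_le_exp_mul {s : ℝ} (hv : ∀ y ∈ P.outcomes (P.data m).1, 0 < v y)
    (hw : ∀ y ∈ P.outcomes (P.data m).1, 0 < w y)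
    (h : ∀ y ∈ P.outcomes (P.data m).1, v y ≤ Real.exp s * w y) :
    P.t₂ (P.data m).1 v ≤ Real.exp s * P.t₂ (P.data m).1 w := by
  rw [t₂, t₂, ← Real.exp_add, Real.exp_le_exp]
  calc _ ≤ ∑ y ∈ P.outcomes (P.data m).1, P.condProb y (P.data m).1 * (s + Real.log (w y)) := by
        refine Finset.sum_le_sum fun y hy =>
          mul_le_mul_of_nonneg_left ?_ (condProb_nonneg _ _)
        have := Real.log_le_log (hv y hy) (h y hy)
        rwa [Real.log_mul (Real.exp_ne_zero _) (hw y hy).ne', Real.log_exp] at this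
    _ = _ := by simp_rw [mul_add]; rw [Finset.sum_add_distrib, ← Finset.sum_mul, sum_condProb,
        one_mul]

/-- The exponents differ by at most `η`, being averages of logarithms of numbers at least 1. Then
`exp a - exp b ≤ exp a * (a - b)`, and `exp a` is itself a value of `t₂`, hence at most `L₂`. -/
theorem abs_t₂_sub_t₂_le {η : ℝ} (hη : 0 ≤ η)
    (hv : ∀ y ∈ P.outcomes (P.data m).1, v y ∈ Set.Icc 1 (P.L₂ B))
    (hw : ∀ y ∈ P.outcomes (P.data m).1, w y ∈ Set.Icc 1 (P.L₂ B))
    (h : ∀ y ∈ P.outcomes (P.data m).1, |v y - w y| ≤ η) :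
    |P.t₂ (P.data m).1 v - P.t₂ (P.data m).1 w| ≤ P.L₂ B * η := by
  have key : ∀ v w : EY → ℝ, (∀ y ∈ P.outcomes (P.data m).1, v y ∈ Set.Icc 1 (P.L₂ B)) →
      (∀ y ∈ P.outcomes (P.data m).1, w y ∈ Set.Icc 1 (P.L₂ B)) →
      (∀ y ∈ P.outcomes (P.data m).1, |v y - w y| ≤ η) →
      P.t₂ (P.data m).1 v - P.t₂ (P.data m).1 w ≤ P.L₂ B * η := by
    intro v w hv hw h
    have hb := t₂_mem_Icc hv
    rw [t₂] at hb
    rw [t₂, t₂]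
    set a := ∑ y ∈ P.outcomes (P.data m).1, P.condProb y (P.data m).1 * Real.log (v y)
    set b := ∑ y ∈ P.outcomes (P.data m).1, P.condProb y (P.data m).1 * Real.log (w y) with hbd
    have hab : a - b ≤ η := by
      calc a - b = ∑ y ∈ P.outcomes (P.data m).1,
            P.condProb y (P.data m).1 * (Real.log (v y) - Real.log (w y)) := by
            simp_rw [mul_sub]
            rw [Finset.sum_sub_distrib]
        _ ≤ ∑ y ∈ P.outcomes (P.data m).1, P.condProb y (P.data m).1 * η := by
            refine Finset.sum_le_sum fun y hy =>
              mul_le_mul_of_nonneg_left ?_ (condProb_nonneg _ _)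
            exact (le_abs_self _).trans
              ((abs_log_sub_log_le (hv y hy).1 (hw y hy).1).trans (h y hy))
        _ = η := by rw [← Finset.sum_mul, sum_condProb, one_mul]
    have h1 : Real.exp b = Real.exp a * Real.exp (b - a) := by
      rw [← Real.exp_add]
      congr 1
      ring
    have h2 := Real.add_one_le_exp (b - a)
    have h3 : 0 < Real.exp a := Real.exp_pos a
    calc Real.exp a - Real.exp b = Real.exp a * (1 - Real.exp (b - a)) := by rw [h1]; ring
      _ ≤ Real.exp a * η := by gcongr; linarith
      _ ≤ P.L₂ B * η := by gcongr; exact hb.2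
  rw [abs_sub_le_iff]
  refine ⟨key v w hv hw h, key w v hw hv fun y hy => ?_⟩
  rw [abs_sub_comm]
  exact h y hy

end Middle

/-! ### Admissible samples and the sampling distributions -/

variable {EX EY EZ : Type*} [MeasurableSpace EX] [MeasurableSpace EY]
  [NormedAddCommGroup EX] [NormedAddCommGroup EY] {d n : ℕ}

/-- All historical covariates stay in the covariate space when they are perturbed by `ξ₁`. -/
def ValidX (P : SCOProblem EX EY EZ d n) (ξ₁ : EX) : Prop := ∀ m, (P.data m).1 + ξ₁ ∈ P.X

/-- All historical outcomes stay in the outcome space when they are perturbed by `ξ₂`. -/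
def ValidY (P : SCOProblem EX EY EZ d n) (ξ₂ : EY) : Prop := ∀ m, (P.data m).2 + ξ₂ ∈ P.Y

/-- The covariates of the sample are historical ones and all perturbations are admissible. -/
structure ValidSample {N₁ N₂ N₃ : ℕ} (P : SCOProblem EX EY EZ d n)
    (s : Sample EX EY N₁ N₂ N₃) : Prop where
  historical : ∀ i, ∃ m, (s.1 i).1 = (P.data m).1
  validX : ∀ j, P.ValidX (s.2.1 j)
  validY : ∀ k, P.ValidY (s.2.2 k)

/-- The empirical counterpart of `φ₂`. -/
def meanT₃ {N : ℕ} (P : SCOProblem EX EY EZ d n) (θ : EuclideanSpace ℝ (Fin d)) (x ξ₁ : EX)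
    (ζ : Fin N → EY) : EY → ℝ :=
  fun y => (1 / N : ℝ) * ∑ k, P.t₃ θ x ξ₁ (ζ k) y

/-- The empirical counterpart of `φ₁`. -/
def meanT₂ {N₂ N₃ : ℕ} (P : SCOProblem EX EY EZ d n) (θ : EuclideanSpace ℝ (Fin d)) (x : EX)
    (ξ : Fin N₂ → EX) (ζ : Fin N₃ → EY) : ℝ :=
  (1 / N₂ : ℝ) * ∑ j, P.t₂ x (P.meanT₃ θ x (ξ j) ζ)

theorem Fhat_eq {N₁ N₂ N₃ : ℕ} (P : SCOProblem EX EY EZ d n) (s : Sample EX EY N₁ N₂ N₃)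
    (θ : EuclideanSpace ℝ (Fin d)) :
    P.Fhat s θ = P.lam * P.eps *
      ((1 / N₁ : ℝ) * ∑ i, Real.log (P.meanT₂ θ (s.1 i).1 s.2.1 s.2.2)) := by
  rw [Fhat, ← mul_assoc, mul_one_div]
  rfl

omit [NormedAddCommGroup EY] in
-- The measure is a finite combination of Dirac masses, so `g` may be arbitrary.
theorem aemeasurable_nominal_map_fst [BorelSpace EX] {P : SCOProblem EX EY EZ d n}
    (g : EX → ℝ) : AEMeasurable g (P.nominal.map Prod.fst) := by
  have : P.nominal.map Prod.fst = (n : ℝ≥0∞)⁻¹ • Measure.sum fun m =>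
      Measure.dirac (P.data m).1 := by
    rw [nominal, Measure.map_smul, ← Measure.sum_fintype,
      Measure.map_sum measurable_fst.aemeasurable]
    simp_rw [Measure.map_dirac' measurable_fst]
  rw [this]
  exact (AEMeasurable.sum_measure fun m => aemeasurable_dirac).smul_measure _

theorem F_eq [BorelSpace EX] (P : SCOProblem EX EY EZ d n)
    (θ : EuclideanSpace ℝ (Fin d)) :
    P.F θ = P.lam * P.eps * ∫ z, Real.log (P.φ₁ θ z.1) ∂P.nominal := by
  rw [F, integral_map measurable_fst.aemeasurable]
  · rfl
  · exact (aemeasurable_nominal_map_fst _).aestronglyMeasurable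

variable {P : SCOProblem EX EY EZ d n} {D Lθ B : ℝ}

theorem aemeasurable_nominal [BorelSpace EX] [BorelSpace EY] (g : EX × EY → ℝ) :
    AEMeasurable g P.nominal := by
  have : AEMeasurable g (∑ m, Measure.dirac (P.data m)) := by
    rw [← Measure.sum_fintype]
    exact AEMeasurable.sum_measure fun m => aemeasurable_dirac
  exact this.smul_measure _

theorem ae_nominal [BorelSpace EX] [BorelSpace EY] :
    ∀ᵐ z ∂P.nominal, ∃ m, z = P.data m := by
  have : ∀ᵐ z ∂(∑ m, Measure.dirac (P.data m)), ∃ m, z = P.data m := by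
    rw [← Measure.sum_fintype, Measure.ae_sum_iff]
    intro m
    rw [ae_dirac_eq]
    exact ⟨m, rfl⟩
  exact Measure.ae_smul_measure this _

variable [MeasurableSpace EZ]

theorem WellPosed.ae_validX (wp : P.WellPosed) : ∀ᵐ ξ₁ ∂P.Q, P.ValidX ξ₁ :=
  ae_all_iff.2 wp.add_mem_X

theorem WellPosed.ae_validY (wp : P.WellPosed) : ∀ᵐ ξ₂ ∂P.W, P.ValidY ξ₂ :=
  ae_all_iff.2 wp.add_mem_Y

theorem WellPosed.lam_mul_eps_pos (wp : P.WellPosed) : 0 < P.lam * P.eps :=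
  mul_pos wp.lam_pos wp.eps_pos

theorem WellPosed.isProbabilityMeasure_Q (wp : P.WellPosed) : IsProbabilityMeasure P.Q := by
  have : NeZero P.νX := ⟨wp.νX_ne_zero⟩
  exact isProbabilityMeasure_tilted wp.integrable_X

theorem WellPosed.isProbabilityMeasure_W (wp : P.WellPosed) : IsProbabilityMeasure P.W := by
  have : NeZero P.νY := ⟨wp.νY_ne_zero⟩
  exact isProbabilityMeasure_tilted wp.integrable_Y

/-! ### Ranges and parameter dependence of the nested expectations -/

section Bounds

variable {θ θ' : EuclideanSpace ℝ (Fin d)} {m : Fin n} {ξ₁ : EX} {ξ₂ : EY} {y : EY}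

theorem t₃_mem_Icc (wp : P.WellPosed) (bl : P.BoundedLipschitz D Lθ B) (hθ : θ ∈ P.Θ)
    (h₁ : (P.data m).1 + ξ₁ ∈ P.X) (h₂ : P.ValidY ξ₂) (hy : y ∈ P.outcomes (P.data m).1) :
    P.t₃ θ (P.data m).1 ξ₁ ξ₂ y ∈ Set.Icc 1 (P.L₂ B) := by
  obtain ⟨k, hk⟩ := mem_outcomes.1 hy
  have hyY : y + ξ₂ ∈ P.Y := by simpa [hk] using h₂ k
  obtain ⟨h0, hB⟩ := bl.bounded _ (wp.f_mem θ hθ _ h₁) _ hyY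
  have hl := wp.lam_mul_eps_pos
  rw [t₃, L₂, Set.mem_Icc, Real.one_le_exp_iff, Real.exp_le_exp]
  exact ⟨by positivity, by gcongr⟩

/-- Comparing multiplicatively rather than additively keeps `L₂` and `L₃` out of the Lipschitz
constants of the two objectives. -/
theorem t₃_le_exp_mul (wp : P.WellPosed) (bl : P.BoundedLipschitz D Lθ B) (hθ : θ ∈ P.Θ)
    (hθ' : θ' ∈ P.Θ) {τ : ℝ} (hτ : Lθ * ‖θ - θ'‖ ≤ τ) (h₁ : (P.data m).1 + ξ₁ ∈ P.X)
    (h₂ : P.ValidY ξ₂) (hy : y ∈ P.outcomes (P.data m).1) :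
    P.t₃ θ (P.data m).1 ξ₁ ξ₂ y ≤
      Real.exp (τ / (P.lam * P.eps)) * P.t₃ θ' (P.data m).1 ξ₁ ξ₂ y := by
  obtain ⟨k, hk⟩ := mem_outcomes.1 hy
  have hyY : y + ξ₂ ∈ P.Y := by simpa [hk] using h₂ k
  have h := (le_abs_self _).trans ((bl.lipschitz _ h₁ _ hyY θ hθ θ' hθ').trans hτ)
  have hl := wp.lam_mul_eps_pos
  rw [t₃, t₃, ← Real.exp_add, Real.exp_le_exp, ← add_div]
  gcongr
  linarith

theorem aemeasurable_t₃ [BorelSpace EY] (wp : P.WellPosed) (x : EX) :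
    AEMeasurable (fun ξ₂ => P.t₃ θ x ξ₁ ξ₂ y) P.W := by
  unfold t₃
  refine (Real.measurable_exp.comp (Measurable.div_const ?_ _)).aemeasurable
  exact wp.measurable_Ψ.comp (measurable_const.prodMk (measurable_const_add y))

theorem ae_t₃_mem_Icc (wp : P.WellPosed) (bl : P.BoundedLipschitz D Lθ B) (hθ : θ ∈ P.Θ)
    (h₁ : (P.data m).1 + ξ₁ ∈ P.X) (hy : y ∈ P.outcomes (P.data m).1) :
    ∀ᵐ ξ₂ ∂P.W, P.t₃ θ (P.data m).1 ξ₁ ξ₂ y ∈ Set.Icc 1 (P.L₂ B) := by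
  filter_upwards [wp.ae_validY] with ξ₂ h₂ using t₃_mem_Icc wp bl hθ h₁ h₂ hy

theorem integrable_t₃ [BorelSpace EY] (wp : P.WellPosed) (bl : P.BoundedLipschitz D Lθ B)
    (hθ : θ ∈ P.Θ) (h₁ : (P.data m).1 + ξ₁ ∈ P.X) (hy : y ∈ P.outcomes (P.data m).1) :
    Integrable (fun ξ₂ => P.t₃ θ (P.data m).1 ξ₁ ξ₂ y) P.W := by
  have := wp.isProbabilityMeasure_W
  exact Integrable.of_mem_Icc 1 (P.L₂ B) (aemeasurable_t₃ wp _) (ae_t₃_mem_Icc wp bl hθ h₁ hy)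

theorem φ₂_mem_Icc [BorelSpace EY] (wp : P.WellPosed) (bl : P.BoundedLipschitz D Lθ B)
    (hθ : θ ∈ P.Θ) (h₁ : (P.data m).1 + ξ₁ ∈ P.X) (hy : y ∈ P.outcomes (P.data m).1) :
    P.φ₂ θ (P.data m).1 ξ₁ y ∈ Set.Icc 1 (P.L₂ B) := by
  have := wp.isProbabilityMeasure_W
  exact integral_mem_Icc (aemeasurable_t₃ wp _) (ae_t₃_mem_Icc wp bl hθ h₁ hy)

theorem φ₂_le_exp_mul [BorelSpace EY] (wp : P.WellPosed) (bl : P.BoundedLipschitz D Lθ B)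
    (hθ : θ ∈ P.Θ) (hθ' : θ' ∈ P.Θ) {τ : ℝ} (hτ : Lθ * ‖θ - θ'‖ ≤ τ)
    (h₁ : (P.data m).1 + ξ₁ ∈ P.X) (hy : y ∈ P.outcomes (P.data m).1) :
    P.φ₂ θ (P.data m).1 ξ₁ y ≤
      Real.exp (τ / (P.lam * P.eps)) * P.φ₂ θ' (P.data m).1 ξ₁ y := by
  rw [φ₂, φ₂, ← integral_const_mul]
  refine integral_mono_ae (integrable_t₃ wp bl hθ h₁ hy)
    ((integrable_t₃ wp bl hθ' h₁ hy).const_mul _) ?_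
  filter_upwards [wp.ae_validY] with ξ₂ h₂ using t₃_le_exp_mul wp bl hθ hθ' hτ h₁ h₂ hy

theorem measurable_φ₂ [BorelSpace EX] [BorelSpace EY] (wp : P.WellPosed) (hθ : θ ∈ P.Θ)
    (x : EX) (y : EY) : Measurable fun ξ₁ => P.φ₂ θ x ξ₁ y := by
  have := wp.isProbabilityMeasure_W
  have h : Measurable (Function.uncurry fun ξ₁ ξ₂ => P.t₃ θ x ξ₁ ξ₂ y) := by
    unfold t₃
    refine Real.measurable_exp.comp (Measurable.div_const ?_ _)
    exact wp.measurable_Ψ.comp ((((wp.measurable_f θ hθ).comp (measurable_const_add x)).comp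
      measurable_fst).prodMk ((measurable_const_add y).comp measurable_snd))
  exact (StronglyMeasurable.integral_prod_right (ν := P.W) h.stronglyMeasurable).measurable

theorem measurable_t₂_φ₂ [BorelSpace EX] [BorelSpace EY] (wp : P.WellPosed) (hθ : θ ∈ P.Θ)
    (x : EX) : Measurable fun ξ₁ => P.t₂ x (P.φ₂ θ x ξ₁) := by
  unfold t₂
  exact Real.measurable_exp.comp (Finset.measurable_fun_sum _ fun y _ =>
    (Real.measurable_log.comp (measurable_φ₂ wp hθ x y)).const_mul _)

theorem ae_t₂_φ₂_mem_Icc [BorelSpace EY] (wp : P.WellPosed) (bl : P.BoundedLipschitz D Lθ B)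
    (hθ : θ ∈ P.Θ) (m : Fin n) :
    ∀ᵐ ξ₁ ∂P.Q, P.t₂ (P.data m).1 (P.φ₂ θ (P.data m).1 ξ₁) ∈ Set.Icc 1 (P.L₂ B) := by
  filter_upwards [wp.ae_validX] with ξ₁ h₁
  exact t₂_mem_Icc fun y hy => φ₂_mem_Icc wp bl hθ (h₁ m) hy

theorem integrable_t₂_φ₂ [BorelSpace EX] [BorelSpace EY] (wp : P.WellPosed)
    (bl : P.BoundedLipschitz D Lθ B) (hθ : θ ∈ P.Θ) (m : Fin n) :
    Integrable (fun ξ₁ => P.t₂ (P.data m).1 (P.φ₂ θ (P.data m).1 ξ₁)) P.Q := by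
  have := wp.isProbabilityMeasure_Q
  exact Integrable.of_mem_Icc 1 (P.L₂ B) (measurable_t₂_φ₂ wp hθ _).aemeasurable
    (ae_t₂_φ₂_mem_Icc wp bl hθ m)

theorem φ₁_mem_Icc [BorelSpace EX] [BorelSpace EY] (wp : P.WellPosed)
    (bl : P.BoundedLipschitz D Lθ B) (hθ : θ ∈ P.Θ) (m : Fin n) :
    P.φ₁ θ (P.data m).1 ∈ Set.Icc 1 (P.L₂ B) := by
  have := wp.isProbabilityMeasure_Q
  exact integral_mem_Icc (measurable_t₂_φ₂ wp hθ _).aemeasurable (ae_t₂_φ₂_mem_Icc wp bl hθ m)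

theorem φ₁_le_exp_mul [BorelSpace EX] [BorelSpace EY] (wp : P.WellPosed)
    (bl : P.BoundedLipschitz D Lθ B) (hθ : θ ∈ P.Θ) (hθ' : θ' ∈ P.Θ) {τ : ℝ}
    (hτ : Lθ * ‖θ - θ'‖ ≤ τ) (m : Fin n) :
    P.φ₁ θ (P.data m).1 ≤ Real.exp (τ / (P.lam * P.eps)) * P.φ₁ θ' (P.data m).1 := by
  rw [φ₁, φ₁, ← integral_const_mul]
  refine integral_mono_ae (integrable_t₂_φ₂ wp bl hθ m)
    ((integrable_t₂_φ₂ wp bl hθ' m).const_mul _) ?_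
  filter_upwards [wp.ae_validX] with ξ₁ h₁
  exact t₂_le_exp_mul
    (fun y hy => zero_lt_one.trans_le (φ₂_mem_Icc wp bl hθ (h₁ m) hy).1)
    (fun y hy => zero_lt_one.trans_le (φ₂_mem_Icc wp bl hθ' (h₁ m) hy).1)
    (fun y hy => φ₂_le_exp_mul wp bl hθ hθ' hτ (h₁ m) hy)

theorem log_le_add_of_le_exp_mul {a b s : ℝ} (ha : 0 < a) (hb : 0 < b)
    (h : a ≤ Real.exp s * b) : Real.log a ≤ s + Real.log b := by
  have := Real.log_le_log ha h
  rwa [Real.log_mul (Real.exp_ne_zero _) hb.ne', Real.log_exp] at this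

theorem ae_log_φ₁_mem_Icc [BorelSpace EX] [BorelSpace EY] (wp : P.WellPosed)
    (bl : P.BoundedLipschitz D Lθ B) (hθ : θ ∈ P.Θ) :
    ∀ᵐ z ∂P.nominal, Real.log (P.φ₁ θ z.1) ∈ Set.Icc 0 (B / (P.lam * P.eps)) := by
  filter_upwards [ae_nominal] with z hz
  obtain ⟨m, rfl⟩ := hz
  have h := φ₁_mem_Icc wp bl hθ m
  refine ⟨Real.log_nonneg h.1, ?_⟩
  rw [← Real.log_exp (B / (P.lam * P.eps))]
  exact Real.log_le_log (zero_lt_one.trans_le h.1) h.2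

theorem integrable_log_φ₁ [BorelSpace EX] [BorelSpace EY] (hn : 0 < n) (wp : P.WellPosed)
    (bl : P.BoundedLipschitz D Lθ B) (hθ : θ ∈ P.Θ) :
    Integrable (fun z : EX × EY => Real.log (P.φ₁ θ z.1)) P.nominal := by
  have := isProbabilityMeasure_nominal (P := P) hn
  exact Integrable.of_mem_Icc 0 _ (aemeasurable_nominal _) (ae_log_φ₁_mem_Icc wp bl hθ)

theorem F_le_add [BorelSpace EX] [BorelSpace EY] (hn : 0 < n) (wp : P.WellPosed)
    (bl : P.BoundedLipschitz D Lθ B) (hθ : θ ∈ P.Θ) (hθ' : θ' ∈ P.Θ) {τ : ℝ}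
    (hτ : Lθ * ‖θ - θ'‖ ≤ τ) : P.F θ ≤ P.F θ' + τ := by
  have := isProbabilityMeasure_nominal (P := P) hn
  have hl := wp.lam_mul_eps_pos
  have h : ∫ z, Real.log (P.φ₁ θ z.1) ∂P.nominal ≤
      ∫ z, (τ / (P.lam * P.eps) + Real.log (P.φ₁ θ' z.1)) ∂P.nominal := by
    refine integral_mono_ae (integrable_log_φ₁ hn wp bl hθ)
      ((integrable_const _).add (integrable_log_φ₁ hn wp bl hθ')) ?_
    filter_upwards [ae_nominal] with z hz
    obtain ⟨m, rfl⟩ := hz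
    exact log_le_add_of_le_exp_mul (zero_lt_one.trans_le (φ₁_mem_Icc wp bl hθ m).1)
      (zero_lt_one.trans_le (φ₁_mem_Icc wp bl hθ' m).1) (φ₁_le_exp_mul wp bl hθ hθ' hτ m)
  rw [integral_add (integrable_const _) (integrable_log_φ₁ hn wp bl hθ')] at h
  simp only [integral_const, probReal_univ, smul_eq_mul, one_mul] at h
  rw [F_eq, F_eq]
  calc _ ≤ P.lam * P.eps * (τ / (P.lam * P.eps) + ∫ z, Real.log (P.φ₁ θ' z.1) ∂P.nominal) := by
        gcongr
    _ = _ := by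
        rw [mul_add, mul_div_cancel₀ _ hl.ne']
        ring

/-! ### The sample average approximation -/

section Empirical

variable {N₁ N₂ N₃ : ℕ} {s : Sample EX EY N₁ N₂ N₃}

theorem meanT₃_mem_Icc (wp : P.WellPosed) (bl : P.BoundedLipschitz D Lθ B) (hN₃ : 0 < N₃)
    (hθ : θ ∈ P.Θ) {ζ : Fin N₃ → EY} (h₁ : P.ValidX ξ₁) (h₂ : ∀ k, P.ValidY (ζ k))
    (hy : y ∈ P.outcomes (P.data m).1) :
    P.meanT₃ θ (P.data m).1 ξ₁ ζ y ∈ Set.Icc 1 (P.L₂ B) :=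
  mean_mem_Icc hN₃ fun k => t₃_mem_Icc wp bl hθ (h₁ m) (h₂ k) hy

theorem meanT₂_mem_Icc (wp : P.WellPosed) (bl : P.BoundedLipschitz D Lθ B) (hN₂ : 0 < N₂)
    (hN₃ : 0 < N₃) (hθ : θ ∈ P.Θ) {ξ : Fin N₂ → EX} {ζ : Fin N₃ → EY}
    (h₁ : ∀ j, P.ValidX (ξ j)) (h₂ : ∀ k, P.ValidY (ζ k)) (m : Fin n) :
    P.meanT₂ θ (P.data m).1 ξ ζ ∈ Set.Icc 1 (P.L₂ B) :=
  mean_mem_Icc hN₂ fun j => t₂_mem_Icc fun _ hy => meanT₃_mem_Icc wp bl hN₃ hθ (h₁ j) h₂ hy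

theorem meanT₂_le_exp_mul (wp : P.WellPosed) (bl : P.BoundedLipschitz D Lθ B)
    (hN₃ : 0 < N₃) (hθ : θ ∈ P.Θ) (hθ' : θ' ∈ P.Θ) {τ : ℝ}
    (hτ : Lθ * ‖θ - θ'‖ ≤ τ) {ξ : Fin N₂ → EX} {ζ : Fin N₃ → EY}
    (h₁ : ∀ j, P.ValidX (ξ j)) (h₂ : ∀ k, P.ValidY (ζ k)) (m : Fin n) :
    P.meanT₂ θ (P.data m).1 ξ ζ ≤
      Real.exp (τ / (P.lam * P.eps)) * P.meanT₂ θ' (P.data m).1 ξ ζ :=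
  mean_le_mul fun j => t₂_le_exp_mul
    (fun _ hy => zero_lt_one.trans_le (meanT₃_mem_Icc wp bl hN₃ hθ (h₁ j) h₂ hy).1)
    (fun _ hy => zero_lt_one.trans_le (meanT₃_mem_Icc wp bl hN₃ hθ' (h₁ j) h₂ hy).1)
    fun _ hy => mean_le_mul fun k => t₃_le_exp_mul wp bl hθ hθ' hτ (h₁ j m) (h₂ k) hy

theorem Fhat_le_add (wp : P.WellPosed) (bl : P.BoundedLipschitz D Lθ B) (hN₁ : 0 < N₁)
    (hN₂ : 0 < N₂) (hN₃ : 0 < N₃) (hs : P.ValidSample s) (hθ : θ ∈ P.Θ) (hθ' : θ' ∈ P.Θ) {τ : ℝ}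
    (hτ : Lθ * ‖θ - θ'‖ ≤ τ) : P.Fhat s θ ≤ P.Fhat s θ' + τ := by
  have hl := wp.lam_mul_eps_pos
  have hN₁' : (0 : ℝ) < N₁ := Nat.cast_pos.2 hN₁
  have h : ∀ i, Real.log (P.meanT₂ θ (s.1 i).1 s.2.1 s.2.2) ≤
      τ / (P.lam * P.eps) + Real.log (P.meanT₂ θ' (s.1 i).1 s.2.1 s.2.2) := by
    intro i
    obtain ⟨m, hm⟩ := hs.historical i
    rw [hm]
    exact log_le_add_of_le_exp_mul
      (zero_lt_one.trans_le (meanT₂_mem_Icc wp bl hN₂ hN₃ hθ hs.validX hs.validY m).1)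
      (zero_lt_one.trans_le (meanT₂_mem_Icc wp bl hN₂ hN₃ hθ' hs.validX hs.validY m).1)
      (meanT₂_le_exp_mul wp bl hN₃ hθ hθ' hτ hs.validX hs.validY m)
  have hsum := Finset.sum_le_sum fun i (_ : i ∈ Finset.univ) => h i
  rw [Finset.sum_add_distrib] at hsum
  simp only [Finset.sum_const, Finset.card_univ, Fintype.card_fin, nsmul_eq_mul] at hsum
  rw [Fhat_eq, Fhat_eq]
  calc _ ≤ P.lam * P.eps * ((1 / N₁ : ℝ) * (N₁ * (τ / (P.lam * P.eps)) +
        ∑ i, Real.log (P.meanT₂ θ' (s.1 i).1 s.2.1 s.2.2))) := by gcongr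
    _ = _ := by
        have h1 : P.lam ≠ 0 := wp.lam_pos.ne'
        have h2 : P.eps ≠ 0 := wp.eps_pos.ne'
        field_simp
        ring

/-- Telescoping over the levels: the inner tolerance carries an extra `1 / L₂` to offset the
Lipschitz constant of `t₂`, so each level contributes `η / (λε)` before the prefactor `λε`, and `η`
after it. -/
theorem abs_Fhat_sub_F_le [BorelSpace EX] [BorelSpace EY] (wp : P.WellPosed)
    (bl : P.BoundedLipschitz D Lθ B) (hN₁ : 0 < N₁) (hN₂ : 0 < N₂) (hN₃ : 0 < N₃)
    (hs : P.ValidSample s) (hθ : θ ∈ P.Θ) {η : ℝ} (hη : 0 ≤ η)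
    (hlev₁ : |(1 / N₁ : ℝ) * ∑ i, Real.log (P.φ₁ θ (s.1 i).1) -
      ∫ z, Real.log (P.φ₁ θ z.1) ∂P.nominal| ≤ η / (P.lam * P.eps))
    (hlev₂ : ∀ m, |(1 / N₂ : ℝ) * ∑ j, P.t₂ (P.data m).1 (P.φ₂ θ (P.data m).1 (s.2.1 j)) -
      P.φ₁ θ (P.data m).1| ≤ η / (P.lam * P.eps))
    (hlev₃ : ∀ m, ∀ y ∈ P.outcomes (P.data m).1, ∀ j,
      |P.meanT₃ θ (P.data m).1 (s.2.1 j) s.2.2 y - P.φ₂ θ (P.data m).1 (s.2.1 j) y| ≤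
        η / (P.lam * P.eps * P.L₂ B)) :
    |P.Fhat s θ - P.F θ| ≤ 3 * η := by
  have hl := wp.lam_mul_eps_pos
  have hL : 0 < P.L₂ B := Real.exp_pos _
  have h₂ : ∀ m, |P.meanT₂ θ (P.data m).1 s.2.1 s.2.2 - P.φ₁ θ (P.data m).1| ≤
      η / (P.lam * P.eps) + η / (P.lam * P.eps) := by
    intro m
    refine (abs_sub_le _ _ _).trans (add_le_add (abs_mean_sub_mean_le hN₂ fun j => ?_) (hlev₂ m))
    have h := abs_t₂_sub_t₂_le (by positivity)
      (fun y hy => meanT₃_mem_Icc wp bl hN₃ hθ (hs.validX j) hs.validY hy)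
      (fun y hy => φ₂_mem_Icc wp bl hθ (hs.validX j m) hy) (fun y hy => hlev₃ m y hy j)
    refine h.trans (le_of_eq ?_)
    field_simp
  have h₁ : |(1 / N₁ : ℝ) * ∑ i, Real.log (P.meanT₂ θ (s.1 i).1 s.2.1 s.2.2) -
      ∫ z, Real.log (P.φ₁ θ z.1) ∂P.nominal| ≤
      η / (P.lam * P.eps) + η / (P.lam * P.eps) + η / (P.lam * P.eps) := by
    refine (abs_sub_le _ _ _).trans (add_le_add (abs_mean_sub_mean_le hN₁ fun i => ?_) hlev₁)
    obtain ⟨m, hm⟩ := hs.historical i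
    rw [hm]
    exact (abs_log_sub_log_le (meanT₂_mem_Icc wp bl hN₂ hN₃ hθ hs.validX hs.validY m).1
      (φ₁_mem_Icc wp bl hθ m).1).trans (h₂ m)
  rw [Fhat_eq, F_eq, ← mul_sub, abs_mul, abs_of_pos hl]
  refine (mul_le_mul_of_nonneg_left h₁ hl.le).trans (le_of_eq ?_)
  rw [mul_add, mul_add, mul_div_cancel₀ _ hl.ne']
  ring

end Empirical

end Bounds

end SCOProblem

end

noncomputable section

/-! ### Deviation events and the union bound -/

namespace SCOProblem

variable {EX EY EZ : Type*} [MeasurableSpace EX] [MeasurableSpace EY]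
  [NormedAddCommGroup EX] [NormedAddCommGroup EY] {d n : ℕ}

/-- The deviation `η` is in the range in which the tails of the three levels are governed by their
variances. -/
structure SmallDeviation (P : SCOProblem EX EY EZ d n) (B η : ℝ) : Prop where
  outer : 0 < P.sigmaSq₁ → η / (P.lam * P.eps) * (B / (P.lam * P.eps) - 0) ≤ 2 * P.sigmaSq₁
  middle : 0 < P.sigmaSq₂ → η / (P.lam * P.eps) * (P.L₂ B - 1) ≤ 2 * P.sigmaSq₂
  inner : 0 < P.sigmaSq₃ → η / (P.lam * P.eps * P.L₂ B) * (P.L₂ B - 1) ≤ 2 * P.sigmaSq₃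

variable [MeasurableSpace EZ] {P : SCOProblem EX EY EZ d n} {D Lθ B η : ℝ}
  {θ : EuclideanSpace ℝ (Fin d)} {N₁ N₂ N₃ : ℕ}

section Variances

variable [BorelSpace EX] [BorelSpace EY]

theorem variance_log_φ₁_le (hn : 0 < n) (wp : P.WellPosed) (bl : P.BoundedLipschitz D Lθ B)
    (hθ : θ ∈ P.Θ) : Var[fun z => Real.log (P.φ₁ θ z.1); P.nominal] ≤ P.sigmaSq₁ := by
  have := isProbabilityMeasure_nominal (P := P) hn
  have h : ∀ θ, Var[fun x => t₁ (P.φ₁ θ x); P.nominal.map Prod.fst] =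
      Var[fun z => Real.log (P.φ₁ θ z.1); P.nominal] := fun θ =>
    variance_map (aemeasurable_nominal_map_fst _) measurable_fst.aemeasurable
  rw [← h]
  -- Popoviciu's inequality bounds the set of variances, so the real `sSup` is a genuine supremum
  -- and not its default value 0.
  refine le_csSup ⟨((B / (P.lam * P.eps) - 0) / 2) ^ 2, ?_⟩ ⟨θ, hθ, rfl⟩
  rintro v ⟨θ', hθ', rfl⟩
  rw [h]
  exact variance_le_sq_of_bounded (ae_log_φ₁_mem_Icc wp bl hθ') (aemeasurable_nominal _)

theorem variance_t₂_φ₂_le (wp : P.WellPosed) (bl : P.BoundedLipschitz D Lθ B)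
    (hθ : θ ∈ P.Θ) (m : Fin n) :
    Var[fun ξ₁ => P.t₂ (P.data m).1 (P.φ₂ θ (P.data m).1 ξ₁); P.Q] ≤ P.sigmaSq₂ := by
  have := wp.isProbabilityMeasure_Q
  refine le_csSup ⟨((P.L₂ B - 1) / 2) ^ 2, ?_⟩ ⟨θ, hθ, m, rfl⟩
  rintro v ⟨θ', hθ', m', rfl⟩
  exact variance_le_sq_of_bounded (ae_t₂_φ₂_mem_Icc wp bl hθ' m')
    (measurable_t₂_φ₂ wp hθ' _).aemeasurable

omit [BorelSpace EX] in
-- The variance of one coordinate is at most the sum over all coordinates, and the number of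
-- coordinates is at most `n`, which makes the supremum finite.
theorem variance_t₃_le (wp : P.WellPosed) (bl : P.BoundedLipschitz D Lθ B) (hθ : θ ∈ P.Θ)
    {m : Fin n} {ξ₁ : EX} (h₁ : (P.data m).1 + ξ₁ ∈ P.X) {y : EY}
    (hy : y ∈ P.outcomes (P.data m).1) :
    Var[fun ξ₂ => P.t₃ θ (P.data m).1 ξ₁ ξ₂ y; P.W] ≤ P.sigmaSq₃ := by
  have := wp.isProbabilityMeasure_W
  refine (Finset.single_le_sum (f := fun y => Var[fun ξ₂ => P.t₃ θ (P.data m).1 ξ₁ ξ₂ y; P.W])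
    (fun y _ => variance_nonneg _ _) hy).trans ?_
  refine le_csSup ⟨n * ((P.L₂ B - 1) / 2) ^ 2, ?_⟩ ⟨θ, hθ, m, ξ₁, h₁, rfl⟩
  rintro v ⟨θ', hθ', m', ξ', h', rfl⟩
  calc _ ≤ ∑ y ∈ P.outcomes (P.data m').1, ((P.L₂ B - 1) / 2) ^ 2 :=
        Finset.sum_le_sum fun y hy =>
          variance_le_sq_of_bounded (ae_t₃_mem_Icc wp bl hθ' h' hy) (aemeasurable_t₃ wp _)
    _ = P.numOutcomes (P.data m').1 * ((P.L₂ B - 1) / 2) ^ 2 := by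
        rw [Finset.sum_const, nsmul_eq_mul, numOutcomes]
    _ ≤ _ := by
        gcongr
        exact numOutcomes_le _

end Variances

theorem isProbabilityMeasure_sampleLaw (hn : 0 < n) (wp : P.WellPosed) :
    IsProbabilityMeasure (P.sampleLaw N₁ N₂ N₃) := by
  have := isProbabilityMeasure_nominal (P := P) hn
  have := wp.isProbabilityMeasure_Q
  have := wp.isProbabilityMeasure_W
  rw [sampleLaw]
  infer_instance

section Projections

variable (hn : 0 < n) (wp : P.WellPosed)
include hn wp

theorem measurePreserving_sample_data :
    MeasurePreserving (fun s : Sample EX EY N₁ N₂ N₃ => s.1) (P.sampleLaw N₁ N₂ N₃)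
      (Measure.pi fun _ => P.nominal) := by
  have := isProbabilityMeasure_nominal (P := P) hn
  have := wp.isProbabilityMeasure_Q
  have := wp.isProbabilityMeasure_W
  exact measurePreserving_fst

theorem measurePreserving_sample_noise :
    MeasurePreserving (fun s : Sample EX EY N₁ N₂ N₃ => s.2) (P.sampleLaw N₁ N₂ N₃)
      ((Measure.pi fun _ => P.Q).prod (Measure.pi fun _ => P.W)) := by
  have := isProbabilityMeasure_nominal (P := P) hn
  have := wp.isProbabilityMeasure_Q
  have := wp.isProbabilityMeasure_W
  exact measurePreserving_snd

theorem measurePreserving_sample_fst :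
    MeasurePreserving (fun s : Sample EX EY N₁ N₂ N₃ => s.2.1) (P.sampleLaw N₁ N₂ N₃)
      (Measure.pi fun _ => P.Q) := by
  have := wp.isProbabilityMeasure_Q
  have := wp.isProbabilityMeasure_W
  exact measurePreserving_fst.comp (measurePreserving_sample_noise hn wp)

theorem measurePreserving_sample_snd :
    MeasurePreserving (fun s : Sample EX EY N₁ N₂ N₃ => s.2.2) (P.sampleLaw N₁ N₂ N₃)
      (Measure.pi fun _ => P.W) := by
  have := wp.isProbabilityMeasure_Q
  have := wp.isProbabilityMeasure_W
  exact measurePreserving_snd.comp (measurePreserving_sample_noise hn wp)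

theorem ae_validSample [BorelSpace EX] [BorelSpace EY] :
    ∀ᵐ s ∂P.sampleLaw N₁ N₂ N₃, P.ValidSample s := by
  have := isProbabilityMeasure_nominal (P := P) hn
  have := wp.isProbabilityMeasure_Q
  have := wp.isProbabilityMeasure_W
  have h1 : ∀ᵐ s : Sample EX EY N₁ N₂ N₃ ∂P.sampleLaw N₁ N₂ N₃,
      ∀ i, ∃ m, s.1 i = P.data m :=
    (measurePreserving_sample_data hn wp).quasiMeasurePreserving.ae <| ae_all_iff.2 fun i =>
      (measurePreserving_eval (fun _ => P.nominal) i).quasiMeasurePreserving.ae ae_nominal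
  have h2 : ∀ᵐ s : Sample EX EY N₁ N₂ N₃ ∂P.sampleLaw N₁ N₂ N₃, ∀ j, P.ValidX (s.2.1 j) :=
    (measurePreserving_sample_fst hn wp).quasiMeasurePreserving.ae <| ae_all_iff.2 fun i =>
      (measurePreserving_eval (fun _ => P.Q) i).quasiMeasurePreserving.ae wp.ae_validX
  have h3 : ∀ᵐ s : Sample EX EY N₁ N₂ N₃ ∂P.sampleLaw N₁ N₂ N₃, ∀ k, P.ValidY (s.2.2 k) :=
    (measurePreserving_sample_snd hn wp).quasiMeasurePreserving.ae <| ae_all_iff.2 fun i =>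
      (measurePreserving_eval (fun _ => P.W) i).quasiMeasurePreserving.ae wp.ae_validY
  filter_upwards [h1, h2, h3] with s h1 h2 h3
  refine ⟨fun i => ?_, h2, h3⟩
  obtain ⟨m, hm⟩ := h1 i
  exact ⟨m, by rw [hm]⟩

end Projections

/-- The samples for which the outer average deviates from its mean. -/
def outerDeviation (P : SCOProblem EX EY EZ d n) (N₁ N₂ N₃ : ℕ) (η : ℝ)
    (θ : EuclideanSpace ℝ (Fin d)) : Set (Sample EX EY N₁ N₂ N₃) :=
  {s | η / (P.lam * P.eps) < |(1 / N₁ : ℝ) * ∑ i, Real.log (P.φ₁ θ (s.1 i).1) -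
    ∫ z, Real.log (P.φ₁ θ z.1) ∂P.nominal|}

/-- The samples for which the middle average deviates from its mean. -/
def middleDeviation (P : SCOProblem EX EY EZ d n) (N₁ N₂ N₃ : ℕ) (η : ℝ)
    (θ : EuclideanSpace ℝ (Fin d)) (m : Fin n) : Set (Sample EX EY N₁ N₂ N₃) :=
  {s | η / (P.lam * P.eps) <
    |(1 / N₂ : ℝ) * ∑ j, P.t₂ (P.data m).1 (P.φ₂ θ (P.data m).1 (s.2.1 j)) -
      P.φ₁ θ (P.data m).1|}

/-- The samples for which an inner average deviates from its mean. -/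
def innerDeviation (P : SCOProblem EX EY EZ d n) (N₁ N₂ N₃ : ℕ) (B η : ℝ)
    (θ : EuclideanSpace ℝ (Fin d)) (m : Fin n) (y : EY) (j : Fin N₂) :
    Set (Sample EX EY N₁ N₂ N₃) :=
  {s | η / (P.lam * P.eps * P.L₂ B) <
    |P.meanT₃ θ (P.data m).1 (s.2.1 j) s.2.2 y - P.φ₂ θ (P.data m).1 (s.2.1 j) y|}

section Deviations

variable [BorelSpace EX] [BorelSpace EY] (hn : 0 < n) (wp : P.WellPosed)
  (bl : P.BoundedLipschitz D Lθ B) (hη : 0 < η) (hsd : P.SmallDeviation B η) (hθ : θ ∈ P.Θ)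
include hn wp bl hη hsd hθ

theorem measureReal_outerDeviation_le (hN₁ : 0 < N₁) :
    (P.sampleLaw N₁ N₂ N₃).real (P.outerDeviation N₁ N₂ N₃ η θ) ≤
      2 * expTerm N₁ (η / (P.lam * P.eps)) (4 * P.sigmaSq₁) := by
  have := isProbabilityMeasure_nominal (P := P) hn
  have := isProbabilityMeasure_sampleLaw (N₁ := N₁) (N₂ := N₂) (N₃ := N₃) hn wp
  have hl := wp.lam_mul_eps_pos
  have h := measureReal_pi_abs_mean_sub_le (aemeasurable_nominal _) (ae_log_φ₁_mem_Icc wp bl hθ)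
    (variance_log_φ₁_le hn wp bl hθ) (div_pos hη hl) hsd.outer hN₁
  refine le_trans ?_ h
  have hmp := measurePreserving_sample_data (N₁ := N₁) (N₂ := N₂) (N₃ := N₃) hn wp
  refine ENNReal.toReal_mono (measure_ne_top _ _) ?_
  rw [← hmp.map_eq]
  -- For an arbitrary set, the measure of a preimage is at most the pushforward measure of the set,
  -- so the event need not be shown measurable.
  exact Measure.le_map_apply hmp.measurable.aemeasurable _

theorem measureReal_middleDeviation_le (hN₂ : 0 < N₂) (m : Fin n) :
    (P.sampleLaw N₁ N₂ N₃).real (P.middleDeviation N₁ N₂ N₃ η θ m) ≤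
      2 * expTerm N₂ (η / (P.lam * P.eps)) (4 * P.sigmaSq₂) := by
  have := wp.isProbabilityMeasure_Q
  have := isProbabilityMeasure_sampleLaw (N₁ := N₁) (N₂ := N₂) (N₃ := N₃) hn wp
  have hl := wp.lam_mul_eps_pos
  have h := measureReal_pi_abs_mean_sub_le (measurable_t₂_φ₂ wp hθ _).aemeasurable
    (ae_t₂_φ₂_mem_Icc wp bl hθ m) (variance_t₂_φ₂_le wp bl hθ m) (div_pos hη hl) hsd.middle hN₂
  refine le_trans ?_ h
  have hmp := measurePreserving_sample_fst (N₁ := N₁) (N₂ := N₂) (N₃ := N₃) hn wp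
  refine ENNReal.toReal_mono (measure_ne_top _ _) ?_
  rw [← hmp.map_eq]
  exact Measure.le_map_apply hmp.measurable.aemeasurable _

/-- Fubini: for a fixed admissible `ξ₁` sample the inner average is an i.i.d. mean in `ξ₂`, with a
tail bound uniform in `ξ₁`. The event has to be measurable here for its product measure to be a
double integral. -/
theorem measureReal_innerDeviation_le (hN₃ : 0 < N₃) {m : Fin n} {y : EY}
    (hy : y ∈ P.outcomes (P.data m).1) (j : Fin N₂) :
    (P.sampleLaw N₁ N₂ N₃).real (P.innerDeviation N₁ N₂ N₃ B η θ m y j) ≤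
      2 * expTerm N₃ (η / (P.lam * P.eps * P.L₂ B)) (4 * P.sigmaSq₃) := by
  have := wp.isProbabilityMeasure_Q
  have := wp.isProbabilityMeasure_W
  have := isProbabilityMeasure_sampleLaw (N₁ := N₁) (N₂ := N₂) (N₃ := N₃) hn wp
  have hl := wp.lam_mul_eps_pos
  have hL : 0 < P.L₂ B := Real.exp_pos _
  set b := 2 * expTerm N₃ (η / (P.lam * P.eps * P.L₂ B)) (4 * P.sigmaSq₃)
  have hb : 0 ≤ b := by
    have : 0 ≤ expTerm N₃ (η / (P.lam * P.eps * P.L₂ B)) (4 * P.sigmaSq₃) := by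
      rw [expTerm]
      split_ifs
      exacts [le_rfl, (Real.exp_pos _).le]
    positivity
  set E : Set ((Fin N₂ → EX) × (Fin N₃ → EY)) :=
    {u | η / (P.lam * P.eps * P.L₂ B) <
      |P.meanT₃ θ (P.data m).1 (u.1 j) u.2 y - P.φ₂ θ (P.data m).1 (u.1 j) y|} with hE
  have ht₃ : Measurable fun u : EX × EY => P.t₃ θ (P.data m).1 u.1 u.2 y := by
    unfold t₃
    refine Real.measurable_exp.comp (Measurable.div_const ?_ _)
    exact wp.measurable_Ψ.comp ((((wp.measurable_f θ hθ).comp (measurable_const_add _)).comp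
      measurable_fst).prodMk ((measurable_const_add y).comp measurable_snd))
  have hmE : MeasurableSet E := by
    refine measurableSet_lt measurable_const (Measurable.abs (Measurable.sub ?_ ?_))
    · unfold meanT₃
      refine Measurable.const_mul (Finset.measurable_fun_sum _ fun k _ => ?_) _
      have hk : Measurable fun u : (Fin N₂ → EX) × (Fin N₃ → EY) => (u.1 j, u.2 k) :=
        ((measurable_pi_apply j).comp measurable_fst).prodMk
          ((measurable_pi_apply k).comp measurable_snd)
      exact ht₃.comp hk
    · exact (measurable_φ₂ wp hθ _ y).comp ((measurable_pi_apply j).comp measurable_fst)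
  refine ENNReal.toReal_le_of_le_ofReal hb ?_
  have hpre : P.innerDeviation N₁ N₂ N₃ B η θ m y j = (fun s => s.2) ⁻¹' E := rfl
  rw [hpre, (measurePreserving_sample_noise hn wp).measure_preimage hmE.nullMeasurableSet,
    Measure.prod_apply hmE]
  calc _ ≤ ∫⁻ _ξ : Fin N₂ → EX, ENNReal.ofReal b ∂(Measure.pi fun _ => P.Q) := by
        refine lintegral_mono_ae ?_
        filter_upwards [(measurePreserving_eval (fun _ : Fin N₂ => P.Q)
          j).quasiMeasurePreserving.ae wp.ae_validX] with ξ hξ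
        rw [← ofReal_measureReal]
        refine ENNReal.ofReal_le_ofReal ?_
        exact measureReal_pi_abs_mean_sub_le (aemeasurable_t₃ wp _)
          (ae_t₃_mem_Icc wp bl hθ (hξ m) hy) (variance_t₃_le wp bl hθ (hξ m) hy)
          (by positivity) hsd.inner hN₃
    _ = _ := by simp

/-- The union runs over all historical covariates instead of the `N₁` sampled ones. Both they and
their outcomes are counted by `n`, since the `n_x` of a single covariate need not bound that of the
others. -/
theorem measureReal_deviation_le (hN₁ : 0 < N₁) (hN₂ : 0 < N₂) (hN₃ : 0 < N₃) :
    (P.sampleLaw N₁ N₂ N₃).real (P.outerDeviation N₁ N₂ N₃ η θ ∪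
      ((⋃ m ∈ Finset.univ, P.middleDeviation N₁ N₂ N₃ η θ m) ∪
        ⋃ m ∈ Finset.univ, ⋃ y ∈ P.outcomes (P.data m).1, ⋃ j ∈ Finset.univ,
          P.innerDeviation N₁ N₂ N₃ B η θ m y j)) ≤
      2 * expTerm N₁ (η / (P.lam * P.eps)) (4 * P.sigmaSq₁) +
      (n * (2 * expTerm N₂ (η / (P.lam * P.eps)) (4 * P.sigmaSq₂)) +
      n * (n * (N₂ * (2 * expTerm N₃ (η / (P.lam * P.eps * P.L₂ B)) (4 * P.sigmaSq₃))))) := by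
  have := isProbabilityMeasure_sampleLaw (N₁ := N₁) (N₂ := N₂) (N₃ := N₃) hn wp
  have hexp : 0 ≤ expTerm N₃ (η / (P.lam * P.eps * P.L₂ B)) (4 * P.sigmaSq₃) := by
    rw [expTerm]
    split_ifs
    exacts [le_rfl, (Real.exp_pos _).le]
  refine (measureReal_union_le _ _).trans (add_le_add
    (measureReal_outerDeviation_le hn wp bl hη hsd hθ hN₁)
    ((measureReal_union_le _ _).trans (add_le_add ?_ ?_)))
  · refine (measureReal_biUnion_finset_le _ _).trans ((Finset.sum_le_sum fun m _ =>
      measureReal_middleDeviation_le hn wp bl hη hsd hθ hN₂ m).trans (le_of_eq ?_))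
    simp
  · refine (measureReal_biUnion_finset_le _ _).trans ((Finset.sum_le_sum (g := fun _ =>
      n * (N₂ * (2 * expTerm N₃ (η / (P.lam * P.eps * P.L₂ B)) (4 * P.sigmaSq₃))))
      fun m _ => ?_).trans (le_of_eq (by simp)))
    refine (measureReal_biUnion_finset_le _ _).trans ((Finset.sum_le_sum (g := fun _ =>
      N₂ * (2 * expTerm N₃ (η / (P.lam * P.eps * P.L₂ B)) (4 * P.sigmaSq₃)))
      fun y hy => ?_).trans ?_)
    · refine (measureReal_biUnion_finset_le _ _).trans ((Finset.sum_le_sum fun j _ =>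
        measureReal_innerDeviation_le hn wp bl hη hsd hθ hN₃ hy j).trans (le_of_eq ?_))
      simp
    · rw [Finset.sum_const, nsmul_eq_mul]
      gcongr
      exact numOutcomes_le _

end Deviations

/-- Off the deviation events the objectives differ by at most `3η` on the net, hence by `3η + 2τ` on
`Θ`, each objective costing one `τ`. Comparing at `θhat` and at `θs` doubles this. -/
theorem measureReal_optimalityGap_gt_le [BorelSpace EX] [BorelSpace EY] (hn : 0 < n)
    (wp : P.WellPosed) (bl : P.BoundedLipschitz D Lθ B) (hη : 0 < η)
    (hsd : P.SmallDeviation B η) {τ : ℝ}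
    {A : Finset (EuclideanSpace ℝ (Fin d))} (hA : ∀ θ ∈ A, θ ∈ P.Θ)
    (hnet : ∀ θ ∈ P.Θ, ∃ θ' ∈ A, Lθ * ‖θ - θ'‖ ≤ τ)
    {θs : EuclideanSpace ℝ (Fin d)} (hθs : θs ∈ P.Θ)
    (hN₁ : 0 < N₁) (hN₂ : 0 < N₂) (hN₃ : 0 < N₃)
    {Ω : Type*} [MeasurableSpace Ω] {μ : Measure Ω} [IsProbabilityMeasure μ]
    {S : Ω → Sample EX EY N₁ N₂ N₃} {θhat : Ω → EuclideanSpace ℝ (Fin d)}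
    (hS : HasLaw S (P.sampleLaw N₁ N₂ N₃) μ)
    (hsol : ∀ᵐ ω ∂μ, P.IsSolution (P.Fhat (S ω)) (θhat ω)) :
    μ.real {ω | P.F (θhat ω) - P.F θs > 6 * η + 4 * τ} ≤
      A.card * (2 * expTerm N₁ (η / (P.lam * P.eps)) (4 * P.sigmaSq₁) +
      (n * (2 * expTerm N₂ (η / (P.lam * P.eps)) (4 * P.sigmaSq₂)) +
      n * (n * (N₂ * (2 * expTerm N₃ (η / (P.lam * P.eps * P.L₂ B)) (4 * P.sigmaSq₃)))))) := by
  have := isProbabilityMeasure_sampleLaw (N₁ := N₁) (N₂ := N₂) (N₃ := N₃) hn wp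
  set U : Set (Sample EX EY N₁ N₂ N₃) := ⋃ θ ∈ A, (P.outerDeviation N₁ N₂ N₃ η θ ∪
      ((⋃ m ∈ Finset.univ, P.middleDeviation N₁ N₂ N₃ η θ m) ∪
        ⋃ m ∈ Finset.univ, ⋃ y ∈ P.outcomes (P.data m).1, ⋃ j ∈ Finset.univ,
          P.innerDeviation N₁ N₂ N₃ B η θ m y j)) with hU
  have hUle : (P.sampleLaw N₁ N₂ N₃).real U ≤
      A.card * (2 * expTerm N₁ (η / (P.lam * P.eps)) (4 * P.sigmaSq₁) +
      (n * (2 * expTerm N₂ (η / (P.lam * P.eps)) (4 * P.sigmaSq₂)) +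
      n * (n * (N₂ * (2 * expTerm N₃ (η / (P.lam * P.eps * P.L₂ B)) (4 * P.sigmaSq₃)))))) := by
    refine (measureReal_biUnion_finset_le _ _).trans ((Finset.sum_le_sum fun θ hθ =>
      measureReal_deviation_le hn wp bl hη hsd (hA θ hθ) hN₁ hN₂ hN₃).trans (le_of_eq ?_))
    rw [Finset.sum_const, nsmul_eq_mul]
  refine le_trans ?_ hUle
  have hSU : μ (S ⁻¹' U) ≤ P.sampleLaw N₁ N₂ N₃ U := by
    rw [← hS.map_eq]
    exact Measure.le_map_apply hS.aemeasurable _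
  -- `θhat` is not assumed measurable, so only outer measures are compared.
  refine ENNReal.toReal_mono (measure_ne_top _ _) (le_trans (measure_mono_ae ?_) hSU)
  have hval : ∀ᵐ ω ∂μ, P.ValidSample (S ω) := by
    refine ae_of_ae_map hS.aemeasurable ?_
    rw [hS.map_eq]
    exact ae_validSample hn wp
  filter_upwards [hval, hsol] with ω hv hs hgap
  by_contra hnot
  have hclose : ∀ θ ∈ A, |P.Fhat (S ω) θ - P.F θ| ≤ 3 * η := by
    intro θ hθ
    have hnot' : S ω ∉ U := hnot
    simp only [hU, Set.mem_iUnion, Set.mem_union, Finset.mem_univ, exists_prop, true_and,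
      not_exists, not_and, not_or] at hnot'
    obtain ⟨h1, h2, h3⟩ := hnot' θ hθ
    exact abs_Fhat_sub_F_le wp bl hN₁ hN₂ hN₃ hv (hA θ hθ) hη.le (not_lt.1 h1)
      (fun m => not_lt.1 (h2 m)) (fun m y hy j => not_lt.1 (h3 m y hy j))
  have huniform : ∀ θ ∈ P.Θ, |P.Fhat (S ω) θ - P.F θ| ≤ 3 * η + 2 * τ := by
    intro θ hθ
    obtain ⟨θ', hθ', hd⟩ := hnet θ hθ
    have hd' : Lθ * ‖θ' - θ‖ ≤ τ := by rwa [norm_sub_rev]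
    have h0 := abs_le.1 (hclose θ' hθ')
    have h1 := Fhat_le_add wp bl hN₁ hN₂ hN₃ hv hθ (hA θ' hθ') hd
    have h2 := Fhat_le_add wp bl hN₁ hN₂ hN₃ hv (hA θ' hθ') hθ hd'
    have h3 := F_le_add hn wp bl hθ (hA θ' hθ') hd
    have h4 := F_le_add hn wp bl (hA θ' hθ') hθ hd'
    rw [abs_le]
    constructor <;> linarith [h0.1, h0.2]
  have h1 := abs_le.1 (huniform _ hs.1)
  have h2 := abs_le.1 (huniform _ hθs)
  have h3 := hs.2 θs hθs
  have h4 : P.F (θhat ω) - P.F θs > 6 * η + 4 * τ := hgap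
  linarith [h1.1, h2.2]

end SCOProblem

end

noncomputable section

/-! ### Absorption of constants and smallness of the deviation -/

namespace SCOProblem

theorem expTerm_nonneg (N : ℕ) (δ V : ℝ) : 0 ≤ expTerm N δ V := by
  rw [expTerm]
  split_ifs
  exacts [le_rfl, (Real.exp_pos _).le]

/-- Write `E` for the exponent `N δ² / V`. The smallness hypothesis says `E > Λ`, so the surplus
`2/5 * E` in the sharper exponent pays for a factor `R ≤ exp (2/5 * Λ)`. -/
theorem mul_expTerm_le_expTerm {N : ℕ} {δ V δ' V' Λ R : ℝ} (hV : V = 0 → V' = 0)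
    (hE : V ≠ 0 → V' ≠ 0 ∧ 7 / 5 * (N * δ ^ 2 / V) ≤ N * δ' ^ 2 / V')
    (hR : R ≤ Real.exp (2 / 5 * Λ)) (hsmall : Real.exp Λ * expTerm N δ V < 1) :
    R * expTerm N δ' V' ≤ expTerm N δ V := by
  by_cases h : V = 0
  · simp [expTerm, h, hV h]
  obtain ⟨h', hE⟩ := hE h
  rw [expTerm, if_neg h, ← Real.exp_add, ← sub_eq_add_neg, Real.exp_lt_one_iff] at hsmall
  simp only [expTerm, if_neg h, if_neg h']
  calc R * Real.exp (-(N * δ' ^ 2 / V')) ≤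
        Real.exp (2 / 5 * Λ) * Real.exp (-(N * δ' ^ 2 / V')) := by gcongr
    _ = Real.exp (2 / 5 * Λ - N * δ' ^ 2 / V') := by rw [← Real.exp_add, sub_eq_add_neg]
    _ ≤ _ := Real.exp_le_exp.2 (by linarith)

/-- The factor 2 makes the exponent at least twice `Λ + log (1/α) + log w`: one copy cancels `exp Λ
* w`, and the other leaves `α / 3` because `Λ ≥ log 3`. -/
theorem exp_mul_mul_expTerm_le {N : ℕ} {δ V Λ α w : ℝ} (hδ : 0 < δ) (hV : 0 ≤ V)
    (hΛ : Real.log 3 ≤ Λ) (hα : 0 < α) (hα1 : α < 1) (hw : 1 ≤ w)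
    (h : 2 * V / δ ^ 2 * (Λ + Real.log (1 / α) + Real.log w) < N) :
    Real.exp Λ * (w * expTerm N δ V) ≤ α / 3 := by
  rcases hV.eq_or_lt with h0 | hpos
  · simp only [expTerm, ← h0, if_true, mul_zero]
    positivity
  have hlogw := Real.log_nonneg hw
  have hlogα : 0 ≤ Real.log (1 / α) := Real.log_nonneg ((one_le_div hα).2 hα1.le)
  have hE : 2 * (Λ + Real.log (1 / α) + Real.log w) ≤ N * δ ^ 2 / V := by
    rw [le_div_iff₀ hpos]
    rw [div_mul_eq_mul_div, div_lt_iff₀ (by positivity)] at h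
    linarith
  have h3 : α / 3 = Real.exp (-Real.log (1 / α) - Real.log 3) := by
    rw [Real.exp_sub, Real.exp_neg, Real.exp_log (by positivity), Real.exp_log (by norm_num)]
    simp
  rw [expTerm, if_neg hpos.ne', h3]
  nth_rewrite 1 [← Real.exp_log (zero_lt_one.trans_le hw)]
  rw [← Real.exp_add, ← Real.exp_add]
  exact Real.exp_le_exp.2 (by linarith)

variable {EX EY EZ : Type*} [MeasurableSpace EX] [MeasurableSpace EY]
  [NormedAddCommGroup EX] [NormedAddCommGroup EY] {d n : ℕ}
  {P : SCOProblem EX EY EZ d n} {D Lθ B : ℝ}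

theorem sigmaSq₁_nonneg : 0 ≤ P.sigmaSq₁ := by
  refine Real.sSup_nonneg ?_
  rintro v ⟨θ, -, rfl⟩
  exact variance_nonneg _ _

theorem sigmaSq₂_nonneg : 0 ≤ P.sigmaSq₂ := by
  refine Real.sSup_nonneg ?_
  rintro v ⟨θ, -, m, rfl⟩
  exact variance_nonneg _ _

theorem sigmaSq₃_nonneg : 0 ≤ P.sigmaSq₃ := by
  refine Real.sSup_nonneg ?_
  rintro v ⟨θ, -, m, ξ₁, -, rfl⟩
  exact Finset.sum_nonneg fun y _ => variance_nonneg _ _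

section Eventually

open Filter Topology

theorem exists_pos_of_eventually_nhdsGT {p : ℝ → Prop} (h : ∀ᶠ δ in 𝓝[>] (0 : ℝ), p δ) :
    ∃ δ₁ : ℝ, 0 < δ₁ ∧ ∀ δ, 0 < δ → δ < δ₁ → p δ := by
  obtain ⟨u, hu, hs⟩ := mem_nhdsGT_iff_exists_Ioo_subset.1 h
  exact ⟨u, hu, fun δ h0 h1 => hs ⟨h0, h1⟩⟩

theorem eventually_le_const_div (K : ℝ) {a : ℝ} (ha : 0 < a) :
    ∀ᶠ δ in 𝓝[>] (0 : ℝ), K ≤ a / δ := by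
  have : Tendsto (fun δ : ℝ => a / δ) (𝓝[>] 0) atTop := by
    simp_rw [div_eq_mul_inv]
    exact tendsto_inv_nhdsGT_zero.const_mul_atTop ha
  exact this.eventually_ge_atTop K

theorem eventually_mul_le {s : ℝ} (hs : 0 < s) (K : ℝ) : ∀ᶠ δ in 𝓝[>] (0 : ℝ), δ * K ≤ s := by
  have h : Tendsto (fun δ : ℝ => δ * K) (𝓝[>] 0) (𝓝 (0 * K)) :=
    (tendsto_id.mul_const K).mono_left nhdsWithin_le_nhds
  rw [zero_mul] at h
  exact h.eventually_le_const hs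

theorem eventually_smallDeviation (P : SCOProblem EX EY EZ d n) (B : ℝ) :
    ∀ᶠ δ in 𝓝[>] (0 : ℝ), P.SmallDeviation B (δ / 7) := by
  have key : ∀ s K : ℝ, ∀ᶠ δ in 𝓝[>] (0 : ℝ), 0 < s → δ * K ≤ 2 * s := by
    intro s K
    by_cases hs : 0 < s
    · filter_upwards [eventually_mul_le (by positivity : 0 < 2 * s) K] with δ h _ using h
    · exact .of_forall fun δ h => absurd h hs
  filter_upwards [key P.sigmaSq₁ (1 / 7 / (P.lam * P.eps) * (B / (P.lam * P.eps) - 0)),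
    key P.sigmaSq₂ (1 / 7 / (P.lam * P.eps) * (P.L₂ B - 1)),
    key P.sigmaSq₃ (1 / 7 / (P.lam * P.eps * P.L₂ B) * (P.L₂ B - 1))] with δ h1 h2 h3
  refine ⟨fun h => (le_of_eq ?_).trans (h1 h), fun h => (le_of_eq ?_).trans (h2 h),
    fun h => (le_of_eq ?_).trans (h3 h)⟩ <;> ring

end Eventually

omit [NormedAddCommGroup EX] [NormedAddCommGroup EY] in
theorem coverRatio_eq (P : SCOProblem EX EY EZ d n) (D B δ : ℝ) :
    P.coverRatio D B δ = 8 * P.L₂ B * P.L₃ B * D / δ := by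
  rw [coverRatio, L₁, mul_one]

/-! ### The tail bound -/

variable [MeasurableSpace EZ]

theorem WellPosed.coverConst_pos (wp : P.WellPosed) (bl : P.BoundedLipschitz D Lθ B) :
    0 < 8 * P.L₂ B * P.L₃ B * D := by
  have := wp.lam_mul_eps_pos
  have := bl.diam_pos
  rw [L₂, L₃]
  positivity

theorem exists_delta_tail_bound.{u} [BorelSpace EX] [BorelSpace EY] (hd : 0 < d) (hn : 0 < n)
    (wp : P.WellPosed) (bl : P.BoundedLipschitz D Lθ B) {θs : EuclideanSpace ℝ (Fin d)}
    (hθs : θs ∈ P.Θ) {κ : ℝ} (hκ : 0 < κ) :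
    ∃ δ₁ : ℝ, 0 < δ₁ ∧ ∀ δ : ℝ, 0 < δ → δ < δ₁ →
      ∀ N₁ N₂ N₃ : ℕ, 0 < N₁ → 0 < N₂ → 0 < N₃ → ∀ m : Fin n,
      ∀ (Ω : Type u) [MeasurableSpace Ω] (μ : Measure Ω)
        [IsProbabilityMeasure μ] (S : Ω → Sample EX EY N₁ N₂ N₃)
        (θhat : Ω → EuclideanSpace ℝ (Fin d)),
        HasLaw S (P.sampleLaw N₁ N₂ N₃) μ →
        (∀ᵐ ω ∂μ, P.IsSolution (P.Fhat (S ω)) (θhat ω)) →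
        μ.real {ω | P.F (θhat ω) - P.F θs > δ} ≤
          P.coverRatio D B δ ^ d * P.tailSum B κ δ N₁ N₂ N₃ (P.data m).1 := by
  have hl := wp.lam_mul_eps_pos
  have hL : 0 < P.L₂ B := Real.exp_pos _
  have ha := wp.coverConst_pos bl
  have hD := bl.diam_pos
  set a := 8 * P.L₂ B * P.L₃ B * D with had
  -- A positive substitute for `Lθ`, which may be zero or negative; the net radius divides by it.
  set M := |Lθ| + 1 with hM
  have hMpos : 0 < M := by positivity
  set b := 140 * d * D * M / a with hb
  have hb0 : 0 ≤ b := by positivity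
  -- All factors to be absorbed: `b` compares the net size with the cover ratio, `n ^ 2` comes from
  -- the union bound and 2 from the two-sided tails.
  set R := b ^ d * (2 * n ^ 2) with hR
  have hR0 : 0 ≤ R := by positivity
  have hd' : (1 : ℝ) ≤ d := by exact_mod_cast hd
  have hn' : (1 : ℝ) ≤ n := by exact_mod_cast hn
  refine exists_pos_of_eventually_nhdsGT ?_
  filter_upwards [eventually_smallDeviation P B,
    eventually_mul_le (mul_pos (by norm_num : (0 : ℝ) < 28) (mul_pos hMpos hD)) 1,
    eventually_le_const_div (Real.exp (5 / 2 * R)) ha, self_mem_nhdsWithin]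
    with δ hsd hδD hA hδ
  have hδ : 0 < δ := hδ
  intro N₁ N₂ N₃ hN₁ hN₂ hN₃ m Ω _ μ _ S θhat hS hsol
  set A := P.coverRatio D B δ with hAd
  have hAa : A = a / δ := coverRatio_eq P D B δ
  have hA0 : 0 < A := hAa ▸ div_pos ha hδ
  set Λ := d * Real.log A with hΛ
  have hAexp : A ^ d = Real.exp Λ := by
    rw [hΛ, Real.exp_nat_mul, Real.exp_log hA0]
  -- As `δ` tends to 0 the cover ratio tends to infinity while `R` stays fixed.
  have hlogA : 5 / 2 * R ≤ Real.log A := by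
    rw [hAa]
    exact (Real.le_log_iff_exp_le (div_pos ha hδ)).2 hA
  have hRΛ : R ≤ Real.exp (2 / 5 * Λ) := by
    have h1 : R ≤ 2 / 5 * Λ := by
      rw [hΛ]
      have : Real.log A ≤ d * Real.log A := le_mul_of_one_le_left (by linarith) hd'
      linarith
    linarith [Real.add_one_le_exp (2 / 5 * Λ)]
  obtain ⟨T, hT, hnet, hcard⟩ := exists_finset_net hd ⟨θs, hθs⟩ bl.dist_le
    (r := δ / (28 * M)) (by positivity) (by
      rw [div_le_iff₀ (by positivity)]
      linarith)
  have hnet' : ∀ θ ∈ P.Θ, ∃ θ' ∈ T, Lθ * ‖θ - θ'‖ ≤ δ / 28 := by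
    intro θ hθ
    obtain ⟨θ', hθ', hr⟩ := hnet θ hθ
    refine ⟨θ', hθ', ?_⟩
    calc Lθ * ‖θ - θ'‖ ≤ M * (δ / (28 * M)) :=
          mul_le_mul (by linarith [le_abs_self Lθ]) hr (norm_nonneg _) hMpos.le
      _ = δ / 28 := by field_simp
  have hcard' : (T.card : ℝ) ≤ A ^ d * b ^ d := by
    rw [← mul_pow]
    refine hcard.trans (le_of_eq ?_)
    congr 1
    rw [hAa, hb]
    field_simp
    norm_num
  have hmain := measureReal_optimalityGap_gt_le hn wp bl (η := δ / 7) (by positivity) hsd hT hnet'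
    hθs hN₁ hN₂ hN₃ hS hsol
  -- The budget is split as `η = δ / 7` and `τ = δ / 28`, the latter realised by the net radius `δ /
  -- (28 M)`.
  have hδeq : 6 * (δ / 7) + 4 * (δ / 28) = δ := by ring
  rw [hδeq] at hmain
  have hN₁' : (1 : ℝ) ≤ N₁ := by exact_mod_cast hN₁
  have hN₂' : (1 : ℝ) ≤ N₂ := by exact_mod_cast hN₂
  have hx : (1 : ℝ) ≤ P.numOutcomes (P.data m).1 := by exact_mod_cast numOutcomes_pos m
  rw [tailSum, hAexp]
  set V₁ := 144 * (2 + κ) * P.lam ^ 2 * P.eps ^ 2 * P.sigmaSq₁ with hV₁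
  set V₂ := 144 * (2 + κ) * P.lam ^ 2 * P.eps ^ 2 * L₁ ^ 2 * P.sigmaSq₂ with hV₂
  set V₃ := 144 * (2 + κ) * P.lam ^ 2 * P.eps ^ 2 * L₁ ^ 2 * P.L₂ B ^ 2 * P.sigmaSq₃ with hV₃
  set e₁ := expTerm N₁ δ V₁
  set e₂ := expTerm N₂ δ V₂
  set e₃ := expTerm N₃ δ V₃
  have he₁ : 0 ≤ e₁ := expTerm_nonneg _ _ _
  have he₂ : 0 ≤ e₂ := expTerm_nonneg _ _ _
  have he₃ : 0 ≤ e₃ := expTerm_nonneg _ _ _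
  set w : ℝ := N₁ * N₂ * P.numOutcomes (P.data m).1 with hw
  have hwN₂ : (N₂ : ℝ) ≤ w := by
    calc (N₂ : ℝ) = 1 * N₂ * 1 := by ring
      _ ≤ w := by rw [hw]; gcongr
  have hw1 : 1 ≤ w := hN₂'.trans hwN₂
  have hlow₃ : e₃ ≤ w * e₃ := le_mul_of_one_le_left he₃ hw1
  have hlow₂ : e₂ ≤ N₁ * e₂ := le_mul_of_one_le_left he₂ hN₁'
  have hexpΛ : 0 < Real.exp Λ := Real.exp_pos _
  -- A claimed bound of at least 1 is trivial; otherwise each of its terms is below 1, as the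
  -- absorption requires.
  by_cases hbig : 1 ≤ Real.exp Λ * (w * e₃ + N₁ * e₂ + e₁)
  · exact measureReal_le_one.trans hbig
  have hlt := not_le.1 hbig
  have hs₁ : Real.exp Λ * e₁ < 1 := by
    refine lt_of_le_of_lt (mul_le_mul_of_nonneg_left ?_ hexpΛ.le) hlt
    linarith
  have hs₂ : Real.exp Λ * e₂ < 1 := by
    refine lt_of_le_of_lt (mul_le_mul_of_nonneg_left ?_ hexpΛ.le) hlt
    linarith
  have hs₃ : Real.exp Λ * e₃ < 1 := by
    refine lt_of_le_of_lt (mul_le_mul_of_nonneg_left ?_ hexpΛ.le) hlt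
    linarith
  -- The available denominator is `4 · 7² = 196`, the claimed one `144 (2 + κ) ≥ 288`; the factor
  -- `7/5` fits because `7 · 196 = 1372 ≤ 1440`.
  have hexponent : ∀ (N : ℕ) (q s : ℝ), 0 < q → 0 ≤ s → 144 * (2 + κ) * q ^ 2 * s ≠ 0 →
      4 * s ≠ 0 ∧ 7 / 5 * (N * δ ^ 2 / (144 * (2 + κ) * q ^ 2 * s)) ≤
        N * (δ / 7 / q) ^ 2 / (4 * s) := by
    intro N q s hq hs hne
    have hs' : 0 < s := hs.lt_of_ne fun h => hne (by rw [← h, mul_zero])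
    refine ⟨by positivity, ?_⟩
    have h1 : N * (δ / 7 / q) ^ 2 / (4 * s) = N * δ ^ 2 / (q ^ 2 * s) * (1 / 196) := by
      field_simp
      ring
    have h2 : 7 / 5 * (N * δ ^ 2 / (144 * (2 + κ) * q ^ 2 * s)) =
        N * δ ^ 2 / (q ^ 2 * s) * (7 / (720 * (2 + κ))) := by
      field_simp
      ring
    rw [h1, h2]
    refine mul_le_mul_of_nonneg_left ?_ (by positivity)
    rw [div_le_div_iff₀ (by positivity) (by norm_num)]
    linarith
  have hzero : ∀ q s : ℝ, 0 < q → 144 * (2 + κ) * q ^ 2 * s = 0 → 4 * s = 0 := by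
    intro q s hq h
    have : 144 * (2 + κ) * q ^ 2 ≠ 0 := by positivity
    simp [(mul_eq_zero.1 h).resolve_left this]
  have hV₁' : V₁ = 144 * (2 + κ) * (P.lam * P.eps) ^ 2 * P.sigmaSq₁ := by
    rw [hV₁]
    ring
  have hV₂' : V₂ = 144 * (2 + κ) * (P.lam * P.eps) ^ 2 * P.sigmaSq₂ := by
    rw [hV₂, L₁]
    ring
  have hV₃' : V₃ = 144 * (2 + κ) * (P.lam * P.eps * P.L₂ B) ^ 2 * P.sigmaSq₃ := by
    rw [hV₃, L₁]
    ring
  have hlL : 0 < P.lam * P.eps * P.L₂ B := by positivity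
  have ht₁ : R * expTerm N₁ (δ / 7 / (P.lam * P.eps)) (4 * P.sigmaSq₁) ≤ e₁ :=
    mul_expTerm_le_expTerm (fun h => hzero _ _ hl (hV₁' ▸ h))
      (fun h => hV₁' ▸ hexponent _ _ _ hl sigmaSq₁_nonneg (hV₁' ▸ h)) hRΛ hs₁
  have ht₂ : R * expTerm N₂ (δ / 7 / (P.lam * P.eps)) (4 * P.sigmaSq₂) ≤ e₂ :=
    mul_expTerm_le_expTerm (fun h => hzero _ _ hl (hV₂' ▸ h))
      (fun h => hV₂' ▸ hexponent _ _ _ hl sigmaSq₂_nonneg (hV₂' ▸ h)) hRΛ hs₂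
  have ht₃ : R * expTerm N₃ (δ / 7 / (P.lam * P.eps * P.L₂ B)) (4 * P.sigmaSq₃) ≤ e₃ :=
    mul_expTerm_le_expTerm (fun h => hzero _ _ hlL (hV₃' ▸ h))
      (fun h => hV₃' ▸ hexponent _ _ _ hlL sigmaSq₃_nonneg (hV₃' ▸ h)) hRΛ hs₃
  set f₁ := expTerm N₁ (δ / 7 / (P.lam * P.eps)) (4 * P.sigmaSq₁)
  set f₂ := expTerm N₂ (δ / 7 / (P.lam * P.eps)) (4 * P.sigmaSq₂)
  set f₃ := expTerm N₃ (δ / 7 / (P.lam * P.eps * P.L₂ B)) (4 * P.sigmaSq₃)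
  have hf₁ : 0 ≤ f₁ := expTerm_nonneg _ _ _
  have hf₂ : 0 ≤ f₂ := expTerm_nonneg _ _ _
  have hf₃ : 0 ≤ f₃ := expTerm_nonneg _ _ _
  have hn2 : (1 : ℝ) ≤ n ^ 2 := one_le_pow₀ hn'
  have hnn : (n : ℝ) ≤ n ^ 2 := le_self_pow₀ hn' two_ne_zero
  calc _ ≤ T.card * (2 * f₁ + (n * (2 * f₂) + n * (n * (N₂ * (2 * f₃))))) := hmain
    _ = T.card * (2 * (1 * f₁ + n * f₂ + n ^ 2 * (N₂ * f₃))) := by ring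
    _ ≤ A ^ d * b ^ d * (2 * (n ^ 2 * f₁ + n ^ 2 * f₂ + n ^ 2 * (N₂ * f₃))) := by gcongr
    _ = Real.exp Λ * (N₂ * (R * f₃) + R * f₂ + R * f₁) := by
        rw [hAexp, hR]
        ring
    _ ≤ Real.exp Λ * (N₂ * e₃ + e₂ + e₁) := by gcongr
    _ ≤ Real.exp Λ * (w * e₃ + N₁ * e₂ + e₁) := by gcongr

/-! ### Sample complexity -/

omit [MeasurableSpace EZ] in
-- At `κ = 1` the variance proxies carry the constant `144 · 3 = 432`, and `864` is twice that. The
-- weights are `1`, `N₁` and `N₁ N₂ n_x`, and each term contributes at most `α / 3`.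
theorem coverRatio_pow_mul_tailSum_le
    (hd : 0 < d) {δ α : ℝ} (hδ : 0 < δ) (hα : 0 < α) (hα1 : α < 1)
    (hA : 3 ≤ P.coverRatio D B δ) {N₁ N₂ N₃ : ℕ} (hN₁ : 0 < N₁) (hN₂ : 0 < N₂) (m : Fin n)
    (h : P.SampleSizesLarge 864 D B δ α N₁ N₂ N₃ (P.data m).1) :
    P.coverRatio D B δ ^ d * P.tailSum B 1 δ N₁ N₂ N₃ (P.data m).1 ≤ α := by
  set A := P.coverRatio D B δ with hAd
  have hA0 : 0 < A := by linarith
  have hd' : (1 : ℝ) ≤ d := by exact_mod_cast hd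
  have hN₁' : (1 : ℝ) ≤ N₁ := by exact_mod_cast hN₁
  have hN₂' : (1 : ℝ) ≤ N₂ := by exact_mod_cast hN₂
  have hx : (1 : ℝ) ≤ P.numOutcomes (P.data m).1 := by exact_mod_cast numOutcomes_pos m
  set Λ := d * Real.log A with hΛd
  have hAexp : A ^ d = Real.exp Λ := by
    rw [hΛd, Real.exp_nat_mul, Real.exp_log hA0]
  have hΛ : Real.log 3 ≤ Λ := by
    have h1 : Real.log 3 ≤ Real.log A := Real.log_le_log (by norm_num) hA
    have h2 : 0 ≤ Real.log 3 := Real.log_nonneg (by norm_num)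
    exact h1.trans (le_mul_of_one_le_left (h2.trans h1) hd')
  obtain ⟨h1, h2, h3⟩ := h
  have hw : (1 : ℝ) ≤ N₁ * N₂ * P.numOutcomes (P.data m).1 :=
    one_le_mul_of_one_le_of_one_le (one_le_mul_of_one_le_of_one_le hN₁' hN₂') hx
  have hs₁ := sigmaSq₁_nonneg (P := P)
  have hs₂ := sigmaSq₂_nonneg (P := P)
  have hs₃ := sigmaSq₃_nonneg (P := P)
  have t₁ := exp_mul_mul_expTerm_le (N := N₁)
    (V := 144 * (2 + 1) * P.lam ^ 2 * P.eps ^ 2 * P.sigmaSq₁) (w := 1)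
    hδ (by positivity) hΛ hα hα1 le_rfl (lt_of_eq_of_lt (by rw [Real.log_one]; ring) h1)
  have t₂ := exp_mul_mul_expTerm_le (N := N₂)
    (V := 144 * (2 + 1) * P.lam ^ 2 * P.eps ^ 2 * L₁ ^ 2 * P.sigmaSq₂) (w := N₁)
    hδ (by positivity) hΛ hα hα1 hN₁' (lt_of_eq_of_lt (by ring) h2)
  have t₃ := exp_mul_mul_expTerm_le (N := N₃)
    (V := 144 * (2 + 1) * P.lam ^ 2 * P.eps ^ 2 * L₁ ^ 2 * P.L₂ B ^ 2 * P.sigmaSq₃)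
    (w := N₁ * N₂ * P.numOutcomes (P.data m).1)
    hδ (by positivity) hΛ hα hα1 hw (lt_of_eq_of_lt (by ring) h3)
  rw [hAexp, tailSum, mul_add, mul_add]
  rw [one_mul] at t₁
  exact (add_le_add (add_le_add t₃ t₂) t₁).trans (by linarith)

/-- The good event need not be measurable; the complement of a measurable hull of the bad event lies
inside it and has large enough probability. -/
theorem exists_measurableSet_of_measureReal_le {Ω : Type*} [MeasurableSpace Ω] {μ : Measure Ω}
    [IsProbabilityMeasure μ] {p : Ω → Prop} {α : ℝ} (h : μ.real {ω | ¬ p ω} ≤ α) :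
    ∃ G : Set Ω, MeasurableSet G ∧ 1 - α ≤ μ.real G ∧ ∀ ω ∈ G, p ω := by
  refine ⟨(toMeasurable μ {ω | ¬ p ω})ᶜ, (measurableSet_toMeasurable _ _).compl, ?_, ?_⟩
  · rw [probReal_compl_eq_one_sub (measurableSet_toMeasurable _ _), measureReal_def,
      measure_toMeasurable, ← measureReal_def]
    linarith
  · intro ω hω
    by_contra hp
    exact hω (subset_toMeasurable μ _ hp)

theorem exists_nat_gt_and_le {u : ℝ} (hu : 0 ≤ u) : ∃ N : ℕ, 0 < N ∧ u < N ∧ (N : ℝ) ≤ 1 + u := by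
  refine ⟨⌊u⌋₊ + 1, Nat.succ_pos _, ?_, ?_⟩
  · exact_mod_cast Nat.lt_floor_add_one u
  · push_cast
    linarith [Nat.floor_le hu]

/-- Since `1 / δ ≤ exp T` and `T ≤ exp T`, the sample size is at most `(1 + G K) exp (3T)`, and
small `δ` bounds the remaining constant by another `exp T`. This keeps `log N₁` and `log N₂` from
spoiling the order of the total. -/
theorem log_natCast_le_four_mul {N : ℕ} {δ α G K T : ℝ} (hN : 0 < N) (hδ : 0 < δ) (hα : 0 < α)
    (hα1 : α < 1) (hT : T = Real.log (1 / δ) + Real.log (1 / α)) (hT0 : 0 ≤ T) (hG : 0 ≤ G)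
    (hK : 0 ≤ K) (hsmall : 1 + G * K ≤ 1 / δ) (hNle : (N : ℝ) ≤ 1 + G / δ ^ 2 * (K * T)) :
    Real.log N ≤ 4 * T := by
  rw [Real.log_le_iff_le_exp (by exact_mod_cast hN)]
  have hlogα : 0 ≤ Real.log (1 / α) := Real.log_nonneg ((one_le_div hα).2 hα1.le)
  have h1 : 1 / δ ≤ Real.exp T := by
    rw [hT, Real.exp_add, Real.exp_log (by positivity)]
    exact le_mul_of_one_le_right (by positivity) (Real.one_le_exp hlogα)
  have h2 : T ≤ Real.exp T := by linarith [Real.add_one_le_exp T]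
  have h3 : 1 ≤ Real.exp T := Real.one_le_exp hT0
  have h4 : G / δ ^ 2 * (K * T) ≤ G * K * Real.exp T ^ 3 := by
    calc G / δ ^ 2 * (K * T) = G * K * ((1 / δ) ^ 2 * T) := by
          field_simp
      _ ≤ G * K * (Real.exp T ^ 2 * Real.exp T) := by gcongr
      _ = _ := by ring
  have h5 : 1 ≤ Real.exp T ^ 3 := one_le_pow₀ h3
  calc (N : ℝ) ≤ 1 + G * K * Real.exp T ^ 3 := by linarith
    _ ≤ (1 + G * K) * Real.exp T ^ 3 := by linarith
    _ ≤ Real.exp T * Real.exp T ^ 3 := by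
        refine mul_le_mul_of_nonneg_right (hsmall.trans h1) (by positivity)
    _ = Real.exp (4 * T) := by
        rw [← pow_succ', ← Real.exp_nat_mul]
        norm_num

/-- Each size is the least natural number above its threshold, chosen in order because later
thresholds involve earlier sizes. The brackets are at most `2dT`, `6dT` and `11dT`, where `11 = 2 +
4 + 4 + 1` accounts for the base term, `log N₁`, `log N₂` and `log n_x`; hence `9504 = 864 · 11`. -/
theorem exists_sampleSizesLarge (wp : P.WellPosed) (bl : P.BoundedLipschitz D Lθ B)
    (hd : 0 < d) {δ α : ℝ} (hδ : 0 < δ) (hα : 0 < α) (hα1 : α < 1)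
    (hA : 3 ≤ P.coverRatio D B δ) (hδ1 : 1 ≤ 1 / δ)
    (ha : 8 * P.L₂ B * P.L₃ B * D ≤ 1 / δ) (hnδ : (n : ℝ) ≤ 1 / δ)
    (hG₁ : 1 + 864 * (P.lam * P.eps) ^ 2 * P.sigmaSq₁ * (2 * d) ≤ 1 / δ)
    (hG₂ : 1 + 864 * (P.lam * P.eps) ^ 2 * (L₁ ^ 2 * P.sigmaSq₂) * (6 * d) ≤ 1 / δ)
    (m : Fin n) :
    ∃ N₁ N₂ N₃ : ℕ, 0 < N₁ ∧ 0 < N₂ ∧ 0 < N₃ ∧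
      P.SampleSizesLarge 864 D B δ α N₁ N₂ N₃ (P.data m).1 ∧
      ((N₁ + N₂ + N₃ : ℕ) : ℝ) ≤ 3 + 9504 * ((P.lam * P.eps) ^ 2 *
          (P.sigmaSq₁ + L₁ ^ 2 * P.sigmaSq₂ + L₁ ^ 2 * P.L₂ B ^ 2 * P.sigmaSq₃)) *
        (d / δ ^ 2) * (Real.log (1 / δ) + Real.log (1 / α)) := by
  have hd' : (1 : ℝ) ≤ d := by exact_mod_cast hd
  have hs₁ := sigmaSq₁_nonneg (P := P)
  have hs₂ : 0 ≤ L₁ ^ 2 * P.sigmaSq₂ := mul_nonneg (sq_nonneg _) sigmaSq₂_nonneg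
  have hs₃ : 0 ≤ L₁ ^ 2 * P.L₂ B ^ 2 * P.sigmaSq₃ := mul_nonneg (by positivity) sigmaSq₃_nonneg
  set s₁ := P.sigmaSq₁
  set s₂ := L₁ ^ 2 * P.sigmaSq₂
  set s₃ := L₁ ^ 2 * P.L₂ B ^ 2 * P.sigmaSq₃
  set q := (P.lam * P.eps) ^ 2 with hq
  have hq0 : 0 ≤ q := sq_nonneg _
  have hlogδ : 0 ≤ Real.log (1 / δ) := Real.log_nonneg hδ1
  have hlogα : 0 ≤ Real.log (1 / α) := Real.log_nonneg ((one_le_div hα).2 hα1.le)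
  set T := Real.log (1 / δ) + Real.log (1 / α) with hT
  have hT0 : 0 ≤ T := by positivity
  have hapos := wp.coverConst_pos bl
  have hlogA0 : 0 ≤ Real.log (P.coverRatio D B δ) := Real.log_nonneg (by linarith)
  have hlogA : Real.log (P.coverRatio D B δ) ≤ 2 * Real.log (1 / δ) := by
    rw [coverRatio_eq, div_eq_mul_one_div, Real.log_mul hapos.ne' (by positivity)]
    linarith [Real.log_le_log hapos ha]
  set M := d * Real.log (P.coverRatio D B δ) + Real.log (1 / α) with hM
  have hM0 : 0 ≤ M := by positivity
  have hMT : M ≤ 2 * d * T := by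
    have h1 : d * Real.log (P.coverRatio D B δ) ≤ d * (2 * Real.log (1 / δ)) := by gcongr
    have h2 : Real.log (1 / α) ≤ d * Real.log (1 / α) := le_mul_of_one_le_left hlogα hd'
    rw [hM, hT]
    nlinarith
  have hTd : T ≤ d * T := le_mul_of_one_le_left hT0 hd'
  obtain ⟨N₁, hN₁, hlt₁, hle₁⟩ := exists_nat_gt_and_le
    (u := 864 * q * s₁ / δ ^ 2 * M) (by positivity)
  have hlog₁ : Real.log N₁ ≤ 4 * T := by
    refine log_natCast_le_four_mul (G := 864 * q * s₁) (K := 2 * d) hN₁ hδ hα hα1 hT hT0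
      (by positivity) (by positivity) hG₁ (hle₁.trans ?_)
    gcongr
  have hlog₁0 : 0 ≤ Real.log N₁ := Real.log_natCast_nonneg _
  obtain ⟨N₂, hN₂, hlt₂, hle₂⟩ := exists_nat_gt_and_le
    (u := 864 * q * s₂ / δ ^ 2 * (M + Real.log N₁)) (by positivity)
  have hM₂ : M + Real.log N₁ ≤ 6 * d * T := by linarith
  have hlog₂ : Real.log N₂ ≤ 4 * T := by
    refine log_natCast_le_four_mul (G := 864 * q * s₂) (K := 6 * d) hN₂ hδ hα hα1 hT hT0
      (by positivity) (by positivity) hG₂ (hle₂.trans ?_)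
    gcongr
  have hlog₂0 : 0 ≤ Real.log N₂ := Real.log_natCast_nonneg _
  have hx : 0 < P.numOutcomes (P.data m).1 := numOutcomes_pos m
  have hlogx : Real.log (P.numOutcomes (P.data m).1) ≤ T := by
    have h1 : (P.numOutcomes (P.data m).1 : ℝ) ≤ 1 / δ :=
      le_trans (by exact_mod_cast numOutcomes_le _) hnδ
    linarith [Real.log_le_log (by exact_mod_cast hx) h1]
  have hlogx0 : 0 ≤ Real.log (P.numOutcomes (P.data m).1) := Real.log_natCast_nonneg _
  have hsplit : Real.log (N₁ * N₂ * P.numOutcomes (P.data m).1) =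
      Real.log N₁ + Real.log N₂ + Real.log (P.numOutcomes (P.data m).1) := by
    rw [Real.log_mul (by positivity) (by positivity), Real.log_mul (by positivity) (by positivity)]
  have hM₃ : M + Real.log (N₁ * N₂ * P.numOutcomes (P.data m).1) ≤ 11 * d * T := by
    rw [hsplit]
    linarith
  have hM₃0 : 0 ≤ M + Real.log (N₁ * N₂ * P.numOutcomes (P.data m).1) := by
    rw [hsplit]
    positivity
  obtain ⟨N₃, hN₃, hlt₃, hle₃⟩ := exists_nat_gt_and_le
    (u := 864 * q * s₃ / δ ^ 2 * (M + Real.log (N₁ * N₂ * P.numOutcomes (P.data m).1)))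
    (by positivity)
  refine ⟨N₁, N₂, N₃, hN₁, hN₂, hN₃, ⟨hlt₁, hlt₂, hlt₃⟩, ?_⟩
  push_cast
  have hdT : 0 ≤ d * T := by positivity
  have b₁ : 864 * q * s₁ / δ ^ 2 * M ≤ 864 * q * s₁ / δ ^ 2 * (11 * d * T) := by
    gcongr
    linarith
  have b₂ : 864 * q * s₂ / δ ^ 2 * (M + Real.log N₁) ≤ 864 * q * s₂ / δ ^ 2 * (11 * d * T) := by
    gcongr
    linarith
  have b₃ : 864 * q * s₃ / δ ^ 2 * (M + Real.log (N₁ * N₂ * P.numOutcomes (P.data m).1)) ≤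
      864 * q * s₃ / δ ^ 2 * (11 * d * T) := by gcongr
  have hsum : 9504 * (q * (s₁ + s₂ + s₃)) * (d / δ ^ 2) * T =
      864 * q * s₁ / δ ^ 2 * (11 * d * T) + 864 * q * s₂ / δ ^ 2 * (11 * d * T) +
        864 * q * s₃ / δ ^ 2 * (11 * d * T) := by ring
  rw [hsum]
  linarith

end SCOProblem

end

/-! ### The main theorem -/

theorem theorem3 :
    ∃ C c c' : ℝ, 0 < C ∧ 0 < c ∧ 0 < c' ∧
    ∀ (EX : Type*) (EY : Type*) (EZ : Type*)
      [NormedAddCommGroup EX] [NormedSpace ℝ EX] [FiniteDimensional ℝ EX]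
      [MeasurableSpace EX] [BorelSpace EX]
      [NormedAddCommGroup EY] [NormedSpace ℝ EY] [FiniteDimensional ℝ EY]
      [MeasurableSpace EY] [BorelSpace EY]
      [MeasurableSpace EZ]
      (d n : ℕ), 0 < d → 0 < n →
    ∀ (P : SCOProblem EX EY EZ d n) (D Lθ B : ℝ), P.WellPosed → P.BoundedLipschitz D Lθ B →
    ∀ θs, P.IsSolution P.F θs →
      (∀ κ : ℝ, 0 < κ → ∃ δ₁ : ℝ, 0 < δ₁ ∧ ∀ δ : ℝ, 0 < δ → δ < δ₁ →
        ∀ N₁ N₂ N₃ : ℕ, 0 < N₁ → 0 < N₂ → 0 < N₃ → ∀ m : Fin n,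
        ∀ (Ω : Type*) [MeasurableSpace Ω] (μ : MeasureTheory.Measure Ω)
          [MeasureTheory.IsProbabilityMeasure μ] (S : Ω → SCOProblem.Sample EX EY N₁ N₂ N₃)
          (θhat : Ω → EuclideanSpace ℝ (Fin d)),
          ProbabilityTheory.HasLaw S (P.sampleLaw N₁ N₂ N₃) μ →
          (∀ᵐ ω ∂μ, P.IsSolution (P.Fhat (S ω)) (θhat ω)) →
          μ.real {ω | P.F (θhat ω) - P.F θs > δ} ≤
            C * P.coverRatio D B δ ^ d * P.tailSum B κ δ N₁ N₂ N₃ (P.data m).1) ∧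
      (∃ δ₁ : ℝ, 0 < δ₁ ∧ ∀ δ : ℝ, 0 < δ → δ < δ₁ → ∀ α : ℝ, 0 < α → α < 1 → ∀ m : Fin n,
        (∀ N₁ N₂ N₃ : ℕ, 0 < N₁ → 0 < N₂ → 0 < N₃ →
          P.SampleSizesLarge c D B δ α N₁ N₂ N₃ (P.data m).1 →
          ∀ (Ω : Type*) [MeasurableSpace Ω] (μ : MeasureTheory.Measure Ω)
            [MeasureTheory.IsProbabilityMeasure μ] (S : Ω → SCOProblem.Sample EX EY N₁ N₂ N₃)
            (θhat : Ω → EuclideanSpace ℝ (Fin d)),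
            ProbabilityTheory.HasLaw S (P.sampleLaw N₁ N₂ N₃) μ →
            (∀ᵐ ω ∂μ, P.IsSolution (P.Fhat (S ω)) (θhat ω)) →
            ∃ G : Set Ω, MeasurableSet G ∧ 1 - α ≤ μ.real G ∧
              ∀ ω ∈ G, P.F (θhat ω) - P.F θs ≤ δ) ∧
        (∃ N₁ N₂ N₃ : ℕ, 0 < N₁ ∧ 0 < N₂ ∧ 0 < N₃ ∧
          P.SampleSizesLarge c D B δ α N₁ N₂ N₃ (P.data m).1 ∧
          ((N₁ + N₂ + N₃ : ℕ) : ℝ) ≤ 3 + c' * ((P.lam * P.eps) ^ 2 *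
              (P.sigmaSq₁ + SCOProblem.L₁ ^ 2 * P.sigmaSq₂
                + SCOProblem.L₁ ^ 2 * P.L₂ B ^ 2 * P.sigmaSq₃)) *
            (d / δ ^ 2) * (Real.log (1 / δ) + Real.log (1 / α)))) := by

  refine ⟨1, 864, 9504, by norm_num, by norm_num, by norm_num, ?_⟩
  intro EX EY EZ _ _ _ _ _ _ _ _ _ _ _ d n hd hn P D Lθ B wp bl θs hθs
  simp only [one_mul]
  refine ⟨fun κ hκ => P.exists_delta_tail_bound hd hn wp bl hθs.1 hκ, ?_⟩
  have ha := wp.coverConst_pos bl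
  -- The second part uses the tail bound at `κ = 1`; the further threshold `δ₁` collects the
  -- smallness conditions on `δ`, none of which involves `α` or the sample sizes.
  obtain ⟨δ₀, hδ₀, htail⟩ := P.exists_delta_tail_bound hd hn wp bl hθs.1 one_pos
  obtain ⟨δ₁, hδ₁, hsmall⟩ := SCOProblem.exists_pos_of_eventually_nhdsGT
    ((SCOProblem.eventually_le_const_div 3 ha).and <|
      (SCOProblem.eventually_le_const_div 1 one_pos).and <|
      (SCOProblem.eventually_le_const_div (8 * P.L₂ B * P.L₃ B * D) one_pos).and <|
      (SCOProblem.eventually_le_const_div n one_pos).and <|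
      (SCOProblem.eventually_le_const_div
        (1 + 864 * (P.lam * P.eps) ^ 2 * P.sigmaSq₁ * (2 * d)) one_pos).and <|
      SCOProblem.eventually_le_const_div
        (1 + 864 * (P.lam * P.eps) ^ 2 * (SCOProblem.L₁ ^ 2 * P.sigmaSq₂) * (6 * d)) one_pos)
  refine ⟨min δ₀ δ₁, lt_min hδ₀ hδ₁, fun δ hδ hlt α hα hα1 m => ?_⟩
  obtain ⟨h3, h1, h8, hnδ, hG₁, hG₂⟩ := hsmall δ hδ (hlt.trans_le (min_le_right _ _))
  have hA : 3 ≤ P.coverRatio D B δ := by rwa [SCOProblem.coverRatio_eq]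
  refine ⟨?_, SCOProblem.exists_sampleSizesLarge wp bl hd hδ hα hα1 hA h1 h8 hnδ hG₁ hG₂ m⟩
  intro N₁ N₂ N₃ hN₁ hN₂ hN₃ hlarge Ω _ μ _ S θhat hS hsol
  refine SCOProblem.exists_measurableSet_of_measureReal_le (p := fun ω =>
    P.F (θhat ω) - P.F θs ≤ δ) ?_
  simp only [not_le]
  exact (htail δ hδ (hlt.trans_le (min_le_left _ _)) N₁ N₂ N₃ hN₁ hN₂ hN₃ m Ω μ S θhat hS hsol).trans
    (SCOProblem.coverRatio_pow_mul_tailSum_le hd hδ hα hα1 hA hN₁ hN₂ m hlarge)
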